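/- Let $q^{1/2}$ and $a^{1/2}$ be independent variables, $z=q^{1/2}-q^{-1/2}$, and for $n\in\mathbb Z$ put $\{n\}_x=x^{n/2}-x^{-n/2}$ and $\{n\}=\{n\}_q$. For a partition $\nu=(\nu_1\ge\nu_2\ge\dots\ge\nu_l>0)$ and $k\in\mathbb Z$ put $\{k\nu\}_x=\prod_{i=1}^{l}\{k\nu_i\}_x$, $\{k\nu\}=\{k\nu\}_q$, and $\mathfrak z_\nu=|\mathrm{Aut}(\nu)|\prod_i\nu_i$, where $|\mathrm{Aut}(\nu)|=\prod_{j\ge1}m_j(\nu)!$ and $m_j(\nu)$ is the number of parts of $\nu$ equal to $j$. Fix a framing $\tau\in\mathbb Z$ and define, for $m\ge1$, $$\mathcal Z_m(q,a)=(-1)^{m\tau}\sum_{|\nu|=m}\frac1{\mathfrak z_\nu}\,\frac{\{m\nu\tau\}}{\{m\}\{m\tau\}}\,\frac{\{\nu\}_a}{\{\nu\}},\qquad g_m(q,a)=\sum_{d\mid m}\mu(d)\,\mathcal Z_{m/d}(q^d,a^d),$$ where $\{m\nu\tau\}=\prod_i\{m\nu_i\tau\}$ and $\mu(d)$ is the Möbius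 function. For $\tau=0$ the quotient $\{m\nu\tau\}/\{m\tau\}$ means the value at $t=1$ of the Laurent polynomial $\prod_i(t^{m\nu_i}-t^{-m\nu_i})/(t^m-t^{-m})$, that is, $m$ if $\nu=(m)$ and $0$ otherwise. **Theorem.** For all $\tau\in\mathbb Z$ and $m\ge1$, $$g_m(q,a)\in z^{-2}\,\mathbb Z[z^2,a^{\pm1/2}].$$ Consequently, $g_m$ has a unique expansion $$g_m(q,a)=\sum_{g\ge0}\ \sum_{Q\in\frac12\mathbb Z}n_{m,g,Q}(\tau)\,z^{2g-2}a^Q,\qquad n_{m,g,Q}(\tau)\in\mathbb Q,$$ as a series in $z$ at $q^{1/2}=1$, with finitely many $Q$ for each $g$. All its coefficients $n_{m,g,Q}(\tau)$, which are the LMOV invariants of the framed unknot $U_\tau$ of genus $g$ with boundary condition $(m)$, are integers, and $n_{m,g,Q}(\tau)=0$ when $g$ or $|Q|$ is sufficiently large (for given $m$ and $\tau$). -/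

import Mathlib

open scoped Nat

noncomputable section

namespace UnknotLMOV

/-- With `x` standing for the square root of the base: the quantum integer
`{n}_{x²} = x ^ n - x ^ (-n)`. -/
def qint {K : Type*} [Field K] (x : K) (n : ℤ) : K := x ^ n - x ^ (-n)

/-- `{kν}_{x²} = ∏ᵢ {k νᵢ}_{x²}`, the product over all parts of the partition `ν`. -/
def qpart {K : Type*} [Field K] (x : K) (k : ℤ) {m : ℕ} (ν : m.Partition) : K :=
  (ν.parts.map fun i => qint x (k * (i : ℤ))).prod

/-- `𝔷_ν = |Aut ν| ∏ᵢ νᵢ`, where `|Aut ν|` is the product of the factorials of the multiplicities. -/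
def zee {m : ℕ} (ν : m.Partition) : ℕ :=
  (∏ i ∈ ν.parts.toFinset, (ν.parts.count i)!) * ν.parts.prod

/-- The quotient `{mντ} / {mτ}` for a partition `ν` of `m`, with `x = q^{1/2}`.
It is the value at `t = x ^ τ` of the Laurent polynomial `∏ᵢ (t^{mνᵢ} - t^{-mνᵢ}) / (t^m - t^{-m})`.
For `τ = 0` this is its value at `t = 1`: it is `m` if `ν = (m)`, and it is `0` if `ν` has at
least two parts. -/
def framingQuot {K : Type*} [Field K] (τ : ℤ) {m : ℕ} (x : K) (ν : m.Partition) : K :=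
  if τ = 0 then (if ν.parts = {m} then (m : K) else 0)
  else qpart x (m * τ) ν / qint x (m * τ)

/-- `𝒵_m(q, a)` for the framing `τ`, as a function of `x = q^{1/2}` and `y = a^{1/2}`. -/
def Zfun {K : Type*} [Field K] (τ : ℤ) (m : ℕ) (x y : K) : K :=
  (-1) ^ ((m : ℤ) * τ) * ∑ ν : m.Partition,
    1 / (zee ν : K) * (framingQuot τ x ν / qint x m) * (qpart y 1 ν / qpart x 1 ν)

/-- `g_m(q, a) = ∑_{d ∣ m} μ(d) 𝒵_{m/d}(q^d, a^d)`, as a function of `x = q^{1/2}`, `y = a^{1/2}`. -/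
def gfun {K : Type*} [Field K] (τ : ℤ) (m : ℕ) (x y : K) : K :=
  ∑ d ∈ m.divisors, (ArithmeticFunction.moebius d : K) * Zfun τ (m / d) (x ^ d) (y ^ d)

/-- The field `ℚ(q^{1/2}, a^{1/2})` of rational functions in two independent variables. -/
abbrev RatField : Type := FractionRing (MvPolynomial (Fin 2) ℚ)

/-- The variable `q^{1/2}`. -/
def qh : RatField := algebraMap (MvPolynomial (Fin 2) ℚ) RatField (MvPolynomial.X 0)

/-- The variable `a^{1/2}`. -/
def ah : RatField := algebraMap (MvPolynomial (Fin 2) ℚ) RatField (MvPolynomial.X 1)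

/-- `z = q^{1/2} - q^{-1/2}`. -/
def zvar : RatField := qh - qh⁻¹

/-- The generating function `g_m(q, a)` of the unknot with framing `τ`, in `ℚ(q^{1/2}, a^{1/2})`. -/
def g (τ : ℤ) (m : ℕ) : RatField := gfun τ m qh ah

/-- The ring `ℤ[z², a^{1/2}, a^{-1/2}]`. -/
def intRing : Subring RatField := Subring.closure {zvar ^ 2, ah, ah⁻¹}

/-- A rational function has no pole along `q^{1/2} = 1`: it has a denominator that is not divisible
by `q^{1/2} - 1`. -/
def RegularAtOne (f : RatField) : Prop :=
  ∃ u v : MvPolynomial (Fin 2) ℚ, ¬ (MvPolynomial.X 0 - 1 ∣ v) ∧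
    f * algebraMap (MvPolynomial (Fin 2) ℚ) RatField v
      = algebraMap (MvPolynomial (Fin 2) ℚ) RatField u

/-- The expansion `g_m(q, a) = ∑_{h ≥ 0} ∑_Q n_{m,h,Q}(τ) z^{2h-2} a^Q`, where `n h k` stands for the
invariant of genus `h` with `Q = k / 2`. For each genus `h` only finitely many `Q` occur, but the
sum over `h` may be infinite: it is the power series expansion in `z` around `q^{1/2} = 1`, i.e.
for every `N`, the difference between `z² g_m` and the part of the sum with `h < N` is `z^{2N}` times
a rational function without a pole along `q^{1/2} = 1`. -/
def IsExpansion (τ : ℤ) (m : ℕ) (n : ℕ → ℤ →₀ ℚ) : Prop :=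
  ∀ N : ℕ, ∃ r : RatField, RegularAtOne r ∧
    zvar ^ 2 * g τ m =
      (∑ h ∈ Finset.range N, (n h).sum fun k c => (c : RatField) * zvar ^ (2 * h) * ah ^ k)
        + zvar ^ (2 * N) * r

end UnknotLMOV

end

/-! For `τ > 0` and `M = nτ`, the product over the parts of `ν` in `𝒵_n` is the power sum product
`p_ν` with `p_k = ({kM}/{k}) {k}_a`. Hence the sum over partitions is a complete homogeneous
function: the coefficient of `Xⁿ` in `∏_{j<M} (1 - y⁻¹x^{M-1-2j}X)/(1 - y x^{M-1-2j}X)`, a Laurent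
polynomial in `x = q^{1/2}`, `y = a^{1/2}` over `ℤ`. Newton's identities give this
(`isNewton_sum_partition`, `isNewton_unknotCoeff`). So `g_m` is `lmovNum`, an integral Laurent
polynomial, divided by `{m}{mτ}`, and the point is that `{m}{mτ}` divides `z² lmovNum`.

This is tested on roots `ζ` of unity. If `ζ^{2mτ} = 1` but `ζ^{2m} ≠ 1`, every summand of `lmovNum`
vanishes (`lmovNum_eq_zero`). If `ζ^{2m} = 1` and `ζ² ≠ 1`, a double zero is needed, that is,
vanishing at `ζ(1+ε)` over the dual numbers (`lmovNum_nearUnit`). Let `d` be the order of `ζ²`.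
Power sums whose index is prohibited by the order of `ζ^{2e}` are multiples of `ε`, and the others
have no `ε`-term. Therefore the summand of `e` depends, up to a sign that is controlled separately,
only on `lcm(d, e)`, and for a prime `p ∣ d` the Möbius signs cancel `e` against `pe`. The factor
`z²` takes care of `ζ = ±1`.

The quotient is invariant under `x ↦ x⁻¹` and `x ↦ -x`, hence a polynomial in `z²` over `ℤ[y, y⁻¹]`.
Negative framings reduce to positive ones by `a ↦ a⁻¹`, and framing `0` is a direct Möbius sum. Its
coefficients form an expansion, which is unique because a nonzero Laurent polynomial in `a^{1/2}`
does not vanish along `q^{1/2} = 1`. -/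

noncomputable section

/-! ### Newton's identities. -/

namespace UnknotLMOV

open Finset PowerSeries

/-- Newton's identities `n hₙ = ∑_{i+j=n} pᵢ hⱼ` between power sums `p` (with `p 0 = 0`) and
complete homogeneous functions `h`. -/
structure IsNewton {R : Type*} [CommRing R] (p h : ℕ → R) : Prop where
  zero : h 0 = 1
  mul_eq : ∀ n : ℕ, (n : R) * h n = ∑ ij ∈ antidiagonal n, p ij.1 * h ij.2

namespace IsNewton

variable {R : Type*} [CommRing R] {p h : ℕ → R}

theorem p_zero (H : IsNewton p h) : p 0 = 0 := by
  have := H.mul_eq 0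
  simpa [H.zero] using this.symm

theorem unique [Algebra ℚ R] {h' : ℕ → R} (H : IsNewton p h) (H' : IsNewton p h') (n : ℕ) :
    h n = h' n := by
  induction n using Nat.strong_induction_on with
  | _ n ih =>
    rcases Nat.eq_zero_or_pos n with rfl | hn
    · rw [H.zero, H'.zero]
    · have h1 : (n : R) * h n = (n : R) * h' n := by
        rw [H.mul_eq, H'.mul_eq]
        refine sum_congr rfl fun ij hij => ?_
        rw [HasAntidiagonal.mem_antidiagonal] at hij
        rcases Nat.eq_zero_or_pos ij.1 with h0 | h0
        · rw [h0, H.p_zero, zero_mul, zero_mul]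
        · rw [ih ij.2 (by omega)]
      have hu : IsUnit (n : R) := by
        have := (IsUnit.mk0 (n : ℚ) (by positivity)).map (algebraMap ℚ R)
        simpa using this
      exact hu.mul_left_cancel h1

theorem scale (H : IsNewton p h) (s : R) :
    IsNewton (fun k => s ^ k * p k) (fun k => s ^ k * h k) where
  zero := by simp [H.zero]
  mul_eq n := by
    rw [mul_left_comm, H.mul_eq, mul_sum]
    refine sum_congr rfl fun ij hij => ?_
    rw [HasAntidiagonal.mem_antidiagonal] at hij
    rw [← hij, pow_add]; ring

/-- If `i + j = n` and `d ∤ n`, then `d ∤ i` or `d ∤ j`, so each term of the recursion has a factor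
in `I`; `n` is a unit. -/
theorem mem_of_not_dvd [Algebra ℚ R] (H : IsNewton p h) (I : Ideal R) {d : ℕ}
    (hp : ∀ k, ¬ d ∣ k → p k ∈ I) (n : ℕ) (hn : ¬ d ∣ n) : h n ∈ I := by
  induction n using Nat.strong_induction_on with
  | _ n ih =>
    have h1 : (n : R) * h n ∈ I := by
      rw [H.mul_eq]
      refine I.sum_mem fun ij hij => ?_
      rw [HasAntidiagonal.mem_antidiagonal] at hij
      by_cases hd : d ∣ ij.1
      · rcases Nat.eq_zero_or_pos ij.1 with h0 | h0
        · rw [h0, H.p_zero, zero_mul]; exact I.zero_mem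
        · refine I.mul_mem_left _ (ih _ (by omega) fun h2 => hn ?_)
          rw [← hij]; exact dvd_add hd h2
      · exact I.mul_mem_right _ (hp _ hd)
    have hu : IsUnit (n : R) := by
      have : n ≠ 0 := by rintro rfl; exact hn (dvd_zero d)
      have := (IsUnit.mk0 (n : ℚ) (by exact_mod_cast this)).map (algebraMap ℚ R)
      simpa using this
    exact (Ideal.unit_mul_mem_iff_mem I hu).1 h1

/-- If the power sums of index prime to `dℤ` lie in an ideal of square zero, then the functions
`h (d n)` only depend on the power sums `p (d k)`. -/
theorem comp_mul [Algebra ℚ R] (H : IsNewton p h) (I : Ideal R)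
    (hI : ∀ a ∈ I, ∀ b ∈ I, a * b = 0) {d : ℕ} (hd : 0 < d)
    (hp : ∀ k, ¬ d ∣ k → p k ∈ I) {p' : ℕ → R} (hp' : ∀ k, (d : R) * p' k = p (d * k)) :
    IsNewton p' (fun n => h (d * n)) where
  zero := by simp [H.zero]
  mul_eq n := by
    have hu : IsUnit (d : R) := by
      have := (IsUnit.mk0 (d : ℚ) (by positivity)).map (algebraMap ℚ R)
      simpa using this
    refine hu.mul_left_cancel ?_
    rw [← mul_assoc, ← Nat.cast_mul, H.mul_eq, mul_sum]
    symm
    refine sum_of_injOn (fun ij => (d * ij.1, d * ij.2)) ?_ ?_ ?_ ?_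
    · rintro ⟨a, b⟩ - ⟨a', b'⟩ - hab
      simp only [Prod.mk.injEq] at hab
      rw [Nat.eq_of_mul_eq_mul_left hd hab.1, Nat.eq_of_mul_eq_mul_left hd hab.2]
    · rintro ⟨a, b⟩ hab
      simp only [mem_coe, HasAntidiagonal.mem_antidiagonal] at hab ⊢
      rw [← hab, mul_add]
    · rintro ⟨a, b⟩ hab hn
      simp only [HasAntidiagonal.mem_antidiagonal] at hab
      have ha : ¬ d ∣ a := by
        rintro ⟨a', rfl⟩
        obtain ⟨b', rfl⟩ : d ∣ b := by
          refine (Nat.dvd_add_right (Dvd.intro a' rfl)).1 (hab ▸ Dvd.intro n rfl)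
        refine hn ⟨(a', b'), ?_, rfl⟩
        simp only [mem_coe, HasAntidiagonal.mem_antidiagonal]
        rw [← mul_add] at hab
        exact Nat.eq_of_mul_eq_mul_left hd hab
      -- The sum of the indices is divisible by `d`, so neither is; both factors lie in `I`, whose
      -- products vanish.
      have hb : ¬ d ∣ b := fun hb =>
        ha ((Nat.dvd_add_left hb).1 (hab ▸ Dvd.intro n rfl))
      exact hI _ (hp _ ha) _ (H.mem_of_not_dvd I hp _ hb)
    · rintro ⟨a, b⟩ -
      simp only
      rw [← hp', mul_assoc]

/-- In the form `X F' = P F` the identities concern a logarithmic derivative, so power sums add when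
series are multiplied. -/
theorem iff_powerSeries (F : R⟦X⟧) :
    IsNewton p (fun n => coeff n F) ↔
      constantCoeff F = 1 ∧ X * d⁄dX R F = PowerSeries.mk p * F := by
  have key : ∀ n, coeff n (X * d⁄dX R F) = n * coeff n F := by
    rintro (_ | n)
    · simp
    · rw [coeff_succ_X_mul, coeff_derivative]; push_cast; ring
  constructor
  · intro H
    refine ⟨by simpa using H.zero, ?_⟩
    ext n
    rw [key, H.mul_eq, coeff_mul]; simp
  · rintro ⟨h0, h1⟩
    refine ⟨by simpa using h0, fun n => ?_⟩
    rw [← key, h1, coeff_mul]; simp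

theorem mul {p' : ℕ → R} {F G : R⟦X⟧} (H : IsNewton p (fun n => coeff n F))
    (H' : IsNewton p' (fun n => coeff n G)) :
    IsNewton (fun k => p k + p' k) (fun n => coeff n (F * G)) := by
  rw [iff_powerSeries] at *
  refine ⟨by simp [H.1, H'.1], ?_⟩
  have h3 : PowerSeries.mk (fun k => p k + p' k) = PowerSeries.mk p + PowerSeries.mk p' := by
    ext; simp
  rw [h3, Derivation.leibniz, smul_eq_mul, smul_eq_mul]
  linear_combination F * H'.2 + G * H.2

theorem one : IsNewton (fun _ => 0) (fun n => coeff n (1 : R⟦X⟧)) := by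
  rw [iff_powerSeries]
  refine ⟨by simp, ?_⟩
  have h3 : PowerSeries.mk (fun _ => (0 : R)) = 0 := by ext; simp
  rw [h3]; simp

theorem prod {ι : Type*} (s : Finset ι) {p : ι → ℕ → R} {F : ι → R⟦X⟧}
    (H : ∀ i ∈ s, IsNewton (p i) (fun n => coeff n (F i))) :
    IsNewton (fun k => ∑ i ∈ s, p i k) (fun n => coeff n (∏ i ∈ s, F i)) := by
  classical
  induction s using Finset.induction_on with
  | empty => simpa using one
  | insert a s ha ih =>
    simp only [sum_insert ha, prod_insert ha]
    exact (H a (mem_insert_self a s)).mul (ih fun i hi => H i (mem_insert_of_mem hi))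

theorem one_sub_mul_mk (b : R) : (1 - C b * X) * PowerSeries.mk (fun n => b ^ n) = 1 := by
  ext (_ | n)
  · simp [sub_mul, mul_assoc]
  · simp [sub_mul, mul_assoc, coeff_succ_X_mul, coeff_one, pow_succ']

theorem linear_factor (a b : R) :
    IsNewton (fun k => a ^ k - b ^ k)
      (fun n => coeff n ((1 - C b * X) * PowerSeries.mk (fun n => a ^ n))) := by
  rw [iff_powerSeries]
  refine ⟨?_, ?_⟩
  · rw [map_mul, ← coeff_zero_eq_constantCoeff_apply (PowerSeries.mk _), coeff_mk]
    simp
  have h3 : PowerSeries.mk (fun k => a ^ k - b ^ k)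
      = PowerSeries.mk (fun k => a ^ k) - PowerSeries.mk (fun k => b ^ k) := by
    ext; simp
  have hA := one_sub_mul_mk a
  have hB := one_sub_mul_mk b
  rw [h3]
  set G := PowerSeries.mk (fun k => a ^ k)
  set B := PowerSeries.mk (fun k => b ^ k)
  have hd : ∀ c : R, d⁄dX R (1 - C c * X) = - C c := by
    intro c
    rw [map_sub, Derivation.leibniz]
    simp
  -- Differentiating `(1 - aX) G = 1` gives `G'` without any division.
  have hA' := congrArg (d⁄dX R) hA
  rw [Derivation.leibniz, hd, smul_eq_mul, smul_eq_mul, Derivation.map_one_eq_zero] at hA'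
  rw [Derivation.leibniz, hd, smul_eq_mul, smul_eq_mul]
  linear_combination (1 - C b * X) * G * X * hA' - ((1 - C b * X) * X * d⁄dX R G + (1 - C b * X) * G) * hA + G * hB

end IsNewton

/-! ### The sum over partitions -/

/-- `𝔷_s` for a multiset `s`. -/
def mzee (s : Multiset ℕ) : ℕ := (∏ i ∈ s.toFinset, (s.count i)!) * s.prod

theorem mzee_cons (k : ℕ) (s : Multiset ℕ) :
    mzee (k ::ₘ s) = k * (s.count k + 1) * mzee s := by
  -- Both factorial products are taken over one index set; the added factors are `0! = 1`.
  have h1 : ∀ (t : Multiset ℕ) (T : Finset ℕ), t.toFinset ⊆ T →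
      ∏ i ∈ t.toFinset, (t.count i)! = ∏ i ∈ T, (t.count i)! := by
    intro t T hT
    refine prod_subset hT fun i _ hi => ?_
    rw [Multiset.mem_toFinset, ← Multiset.count_eq_zero] at hi
    rw [hi, Nat.factorial_zero]
  have hk : k ∈ insert k s.toFinset := mem_insert_self _ _
  unfold mzee
  rw [h1 (k ::ₘ s) (insert k s.toFinset) (by simp), h1 s (insert k s.toFinset) (by simp),
    ← mul_prod_erase _ _ hk, ← mul_prod_erase _ _ hk, Multiset.count_cons_self,
    Nat.factorial_succ, Multiset.prod_cons]
  have h2 : ∏ i ∈ (insert k s.toFinset).erase k, (Multiset.count i (k ::ₘ s))!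
      = ∏ i ∈ (insert k s.toFinset).erase k, (Multiset.count i s)! := by
    refine prod_congr rfl fun i hi => ?_
    rw [Multiset.count_cons_of_ne (ne_of_mem_erase hi)]
  rw [h2]; ring

theorem mzee_pos (s : Multiset ℕ) (hs : ∀ i ∈ s, 0 < i) : 0 < mzee s := by
  refine Nat.mul_pos (prod_pos fun i _ => Nat.factorial_pos _) ?_
  exact Nat.pos_of_ne_zero (Multiset.prod_ne_zero fun h => (hs 0 h).ne' rfl)

/-- Double counting of partitions with a marked part: `n` is the sum of `i` times the multiplicity
of `i`, and removing one copy of the marked part `i` leaves a partition of `n - i`. The weights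
match by `mzee_cons`. -/
theorem isNewton_sum_partition {K : Type*} [Field K] [CharZero K] {p : ℕ → K} (hp : p 0 = 0) :
    IsNewton p (fun n => ∑ ν : n.Partition, 1 / (zee ν : K) * (ν.parts.map p).prod) where
  zero := by
    rw [Fintype.sum_eq_single (default : Nat.Partition 0) (fun x hx => (hx (Subsingleton.elim _ _)).elim)]
    simp [zee]
  mul_eq n := by
    classical
    set w : Multiset ℕ → K := fun s => 1 / (mzee s : K) * (s.map p).prod with hw
    have hwc : ∀ (k : ℕ) (s : Multiset ℕ), 0 < k → (∀ i ∈ s, 0 < i) →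
        (k * (k ::ₘ s).count k : K) * w (k ::ₘ s) = p k * w s := by
      intro k s hk hs
      have h1 : (mzee s : K) ≠ 0 := by exact_mod_cast (mzee_pos s hs).ne'
      have h2 : (k : K) ≠ 0 := by exact_mod_cast hk.ne'
      have h3 : (s.count k + 1 : K) ≠ 0 := by exact_mod_cast (Nat.succ_pos (s.count k)).ne'
      simp only [hw, mzee_cons, Multiset.count_cons_self, Multiset.map_cons, Multiset.prod_cons]
      push_cast
      field_simp
    have hl : (n : K) * ∑ ν : n.Partition, w ν.parts
        = ∑ x ∈ (univ : Finset n.Partition).sigma (fun ν => ν.parts.toFinset),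
          (x.2 * x.1.parts.count x.2 : K) * w x.1.parts := by
      rw [sum_sigma, mul_sum]
      refine sum_congr rfl fun ν _ => ?_
      simp only
      rw [← sum_mul]
      congr 1
      have h1 := ν.parts_sum
      rw [Finset.sum_multiset_count] at h1
      conv_lhs => rw [← h1]
      push_cast
      refine sum_congr rfl fun i _ => ?_
      rw [nsmul_eq_mul, mul_comm]; simp
    have hr : ∑ ij ∈ antidiagonal n, p ij.1 * ∑ ν : ij.2.Partition, w ν.parts
        = ∑ x ∈ ((antidiagonal n).filter (fun ij => ij.1 ≠ 0)).sigma
            (fun ij => (univ : Finset ij.2.Partition)), p x.1.1 * w x.2.parts := by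
      rw [sum_sigma, sum_filter]
      refine sum_congr rfl fun ij _ => ?_
      split_ifs with h0
      · rw [mul_sum]
      · rw [not_not.1 h0, hp, zero_mul]
    refine Eq.trans hl (Eq.trans ?_ hr.symm)
    symm
    refine sum_bij (fun x hx => ⟨⟨x.1.1 ::ₘ x.2.parts, ?_, ?_⟩, x.1.1⟩) ?_ ?_ ?_ ?_
    · intro i hi
      rw [Multiset.mem_cons] at hi
      simp only [mem_sigma, mem_filter, HasAntidiagonal.mem_antidiagonal] at hx
      rcases hi with rfl | hi
      · omega
      · exact x.2.parts_pos hi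
    · simp only [mem_sigma, mem_filter, HasAntidiagonal.mem_antidiagonal] at hx
      rw [Multiset.sum_cons, x.2.parts_sum]; exact hx.1.1
    · rintro ⟨⟨i, j⟩, ν⟩ hx
      simp
    · rintro ⟨⟨i, j⟩, ν⟩ hx ⟨⟨i', j'⟩, ν'⟩ hx' h
      simp only [mem_sigma, mem_filter, HasAntidiagonal.mem_antidiagonal] at hx hx'
      rw [Sigma.mk.injEq] at h
      obtain ⟨h1, h2⟩ := h
      have h2 := eq_of_heq h2
      simp only at h2
      subst h2
      have h3 : j = j' := by omega
      subst h3
      have h4 := congrArg Nat.Partition.parts h1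
      simp only [Multiset.cons_inj_right] at h4
      rw [Nat.Partition.ext h4]
    · rintro ⟨ν, i⟩ hx
      simp only [mem_sigma, mem_univ, true_and, Multiset.mem_toFinset] at hx
      have h1 := Multiset.cons_erase hx
      have h2 : i + (ν.parts.erase i).sum = n := by
        rw [← Multiset.sum_cons, h1, ν.parts_sum]
      refine ⟨⟨(i, (ν.parts.erase i).sum), ⟨ν.parts.erase i, ?_, rfl⟩⟩, ?_, ?_⟩
      · intro j hj
        exact ν.parts_pos (Multiset.mem_of_mem_erase hj)
      · simp only [mem_sigma, mem_filter, HasAntidiagonal.mem_antidiagonal, mem_univ, and_true]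
        exact ⟨h2, (ν.parts_pos hx).ne'⟩
      · simp only [Sigma.mk.injEq, heq_eq_eq, and_true]
        exact Nat.Partition.ext h1
    · rintro ⟨⟨i, j⟩, ν⟩ hx
      simp only [mem_sigma, mem_filter, HasAntidiagonal.mem_antidiagonal] at hx
      exact (hwc _ _ (Nat.pos_of_ne_zero hx.1.2) fun i hi => ν.parts_pos hi).symm

end UnknotLMOV

end

/-! ### The generating series of the unknot and the numerator of `g_m`. -/

noncomputable section

namespace UnknotLMOV

open Finset PowerSeries

/-- The generating series `∏_{j < M} (1 - y⁻¹ x^{M-1-2j} X) / (1 - y x^{M-1-2j} X)`. -/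
def unknotSeries {R : Type*} [CommRing R] (M : ℕ) (x y : Rˣ) : R⟦X⟧ :=
  ∏ j ∈ range M, ((1 - C ((y⁻¹ * x ^ ((M : ℤ) - 1 - 2 * j) : Rˣ) : R) * X) *
    PowerSeries.mk fun n => ((y * x ^ ((M : ℤ) - 1 - 2 * j) : Rˣ) : R) ^ n)

/-- The coefficients of `unknotSeries`. -/
def unknotCoeff {R : Type*} [CommRing R] (M n : ℕ) (x y : Rˣ) : R := coeff n (unknotSeries M x y)

/-- The symmetric geometric sum `∑_{j < M} x ^ (k (M-1-2j)) = {kM} / {k}`. -/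
def symGeom {R : Type*} [CommRing R] (M : ℕ) (x : Rˣ) (k : ℕ) : R :=
  ∑ j ∈ range M, ((x ^ ((k : ℤ) * ((M : ℤ) - 1 - 2 * j)) : Rˣ) : R)

/-- The quantum integer `x ^ k - x ^ (-k)` in a commutative ring. -/
def uqint {R : Type*} [CommRing R] (x : Rˣ) (k : ℤ) : R := ((x ^ k : Rˣ) : R) - ((x ^ (-k) : Rˣ) : R)

section

variable {R : Type*} [CommRing R]

theorem uqint_pow (x : Rˣ) (e : ℕ) (k : ℤ) : uqint (x ^ e) k = uqint x (e * k) := by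
  simp only [uqint, ← zpow_natCast, ← zpow_mul, mul_neg]

theorem symGeom_pow (M : ℕ) (x : Rˣ) (e k : ℕ) : symGeom M (x ^ e) k = symGeom M x (e * k) := by
  simp only [symGeom, ← zpow_natCast, ← zpow_mul, Nat.cast_mul, mul_assoc]

/-- The product telescopes, so no division by `{k}` is needed; this matters at roots of unity. -/
theorem symGeom_mul_uqint (M : ℕ) (x : Rˣ) (k : ℕ) :
    symGeom M x k * uqint x k = uqint x (M * k) := by
  have h : ∀ j : ℕ, ((x ^ ((k : ℤ) * ((M : ℤ) - 1 - 2 * j)) : Rˣ) : R) * uqint x k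
      = ((x ^ ((k : ℤ) * ((M : ℤ) - 2 * j)) : Rˣ) : R)
        - ((x ^ ((k : ℤ) * ((M : ℤ) - 2 * (j + 1 : ℕ))) : Rˣ) : R) := by
    intro j
    rw [uqint, mul_sub, ← Units.val_mul, ← Units.val_mul, ← zpow_add, ← zpow_add]
    congr 4 <;> (push_cast; ring)
  rw [symGeom, sum_mul, sum_congr rfl fun j _ => h j,
    sum_range_sub' (fun j : ℕ => ((x ^ ((k : ℤ) * ((M : ℤ) - 2 * j)) : Rˣ) : R)), uqint,
    show (k : ℤ) * ((M : ℤ) - 2 * (0 : ℕ)) = M * k by push_cast; ring,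
    show (k : ℤ) * ((M : ℤ) - 2 * M) = -(M * k) by ring]

theorem isNewton_unknotCoeff (M : ℕ) (x y : Rˣ) :
    IsNewton (fun k => symGeom M x k * uqint y k) (fun n => unknotCoeff M n x y) := by
  have h := IsNewton.prod (range M) (fun j _ => IsNewton.linear_factor
    ((y * x ^ ((M : ℤ) - 1 - 2 * j) : Rˣ) : R) ((y⁻¹ * x ^ ((M : ℤ) - 1 - 2 * j) : Rˣ) : R))
  suffices h' : (fun k => symGeom M x k * uqint y k) = fun k => ∑ j ∈ range M,
      (((y * x ^ ((M : ℤ) - 1 - 2 * j) : Rˣ) : R) ^ k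
        - ((y⁻¹ * x ^ ((M : ℤ) - 1 - 2 * j) : Rˣ) : R) ^ k) by
    rw [h']; exact h
  funext k
  rw [symGeom, sum_mul]
  refine sum_congr rfl fun j _ => ?_
  rw [uqint, ← Units.val_pow_eq_pow_val, ← Units.val_pow_eq_pow_val, mul_pow, mul_pow, mul_comm,
    sub_mul, ← Units.val_mul, ← Units.val_mul, ← zpow_natCast (x ^ _), ← zpow_mul,
    mul_comm (k : ℤ) (_ - _), zpow_neg, zpow_natCast, inv_pow]

/-- Naturality allows one universal Laurent polynomial to be evaluated at complex numbers, at dual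
numbers and in the function field. -/
theorem map_unknotCoeff {S : Type*} [CommRing S] (f : R →+* S) (M n : ℕ) (x y : Rˣ) :
    f (unknotCoeff M n x y) = unknotCoeff M n (Units.map (f : R →* S) x) (Units.map (f : R →* S) y) := by
  have h : PowerSeries.map f (unknotSeries M x y)
      = unknotSeries M (Units.map (f : R →* S) x) (Units.map (f : R →* S) y) := by
    rw [unknotSeries, unknotSeries, map_prod]
    refine prod_congr rfl fun j _ => ?_
    rw [map_mul]
    congr 1
    · rw [map_sub, map_mul, PowerSeries.map_C, PowerSeries.map_X, map_one, ← map_zpow, ← map_inv,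
        ← map_mul]
      rfl
    · ext n
      rw [coeff_map, coeff_mk, coeff_mk, map_pow, ← map_zpow, ← map_mul]
      rfl
  rw [unknotCoeff, unknotCoeff, ← h, coeff_map]

theorem unknotCoeff_inv (M n : ℕ) (x y : Rˣ) : unknotCoeff M n x⁻¹ y = unknotCoeff M n x y := by
  rw [unknotCoeff, unknotCoeff, unknotSeries, unknotSeries, ← prod_range_reflect]
  congr 1
  refine prod_congr rfl fun j hj => ?_
  have hj := mem_range.1 hj
  have : -((M : ℤ) - 1 - 2 * (M - 1 - j : ℕ)) = (M : ℤ) - 1 - 2 * j := by omega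
  rw [inv_zpow', this]

/-- All exponents `M - 1 - 2j` have the parity of `M + 1`, so the sign change amounts to rescaling
`X` by `(-1)^(M+1)`. -/
theorem unknotCoeff_neg (M n : ℕ) (x y : Rˣ) :
    unknotCoeff M n (-x) y = (-1) ^ ((M + 1) * n) * unknotCoeff M n x y := by
  have hs : ∀ j : ℕ, ((-x) ^ ((M : ℤ) - 1 - 2 * j) : Rˣ)
      = (-1) ^ (M + 1) * x ^ ((M : ℤ) - 1 - 2 * j) := by
    intro j
    rw [← neg_one_mul, mul_zpow]
    congr 1
    rw [show (M : ℤ) - 1 - 2 * j = ((M + 1 : ℕ) : ℤ) + 2 * (-1 - j) by push_cast; ring, zpow_add,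
      zpow_natCast, zpow_mul]
    simp
  have h : unknotSeries M (-x) y = rescale ((-1) ^ (M + 1)) (unknotSeries M x y) := by
    rw [unknotSeries, unknotSeries, map_prod]
    refine prod_congr rfl fun j _ => ?_
    rw [map_mul, hs]
    congr 1
    · rw [map_sub, map_mul, map_one, rescale_X]
      have : ∀ c : R, rescale ((-1 : R) ^ (M + 1)) (C c) = C c := by
        intro c; ext n; rw [coeff_rescale, coeff_C]; split_ifs with h0 <;> simp [h0]
      rw [this, ← mul_assoc (C _) (C _) X, ← C.map_mul]
      congr 3
      push_cast; ring
    · ext n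
      rw [coeff_rescale, coeff_mk, coeff_mk, ← mul_pow]
      congr 1
      push_cast; ring
  rw [unknotCoeff, unknotCoeff, h, coeff_rescale, ← pow_mul]

/-- The numerator `{m} {mτ} g_m` for a framing `τ ≥ 0`. -/
def lmovNum (τ m : ℕ) (x y : Rˣ) : R :=
  ∑ e ∈ m.divisors, (ArithmeticFunction.moebius e : R) *
    ((-1) ^ (m / e * τ) * unknotCoeff (m / e * τ) (m / e) (x ^ e) (y ^ e))

theorem map_lmovNum {S : Type*} [CommRing S] (f : R →+* S) (τ m : ℕ) (x y : Rˣ) :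
    f (lmovNum τ m x y) = lmovNum τ m (Units.map (f : R →* S) x) (Units.map (f : R →* S) y) := by
  simp only [lmovNum, map_sum, map_mul, map_unknotCoeff, map_pow, map_neg, map_one, map_intCast]

theorem lmovNum_inv (τ m : ℕ) (x y : Rˣ) : lmovNum τ m x⁻¹ y = lmovNum τ m x y := by
  simp only [lmovNum, inv_pow, unknotCoeff_inv]

theorem lmovNum_neg (τ m : ℕ) (x y : Rˣ) :
    lmovNum τ m (-x) y = (-1) ^ (m + m * τ) * lmovNum τ m x y := by
  rw [lmovNum, lmovNum, mul_sum]
  refine sum_congr rfl fun e he => ?_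
  obtain ⟨⟨r, rfl⟩, hm⟩ := Nat.mem_divisors.1 he
  have he0 : 0 < e := Nat.pos_of_ne_zero (by rintro rfl; simp at hm)
  rw [Nat.mul_div_cancel_left _ he0]
  rcases Nat.even_or_odd e with h | h
  · rw [h.neg_pow, (show Even (e * r + e * r * τ) by
      rw [Nat.even_add]; simp [h]).neg_one_pow, one_mul]
  · rw [h.neg_pow, unknotCoeff_neg]
    have : ((-1 : R)) ^ ((r * τ + 1) * r) = (-1) ^ (e * r + e * r * τ) := by
      refine neg_one_pow_congr ?_
      simp only [Nat.even_add, Nat.even_mul, Nat.even_add_one, Nat.not_even_iff_odd.2 h]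
      tauto
    rw [this]; ring

end

/-! ### Closed formulas for `𝒵_m` and `g_m`. -/

section

variable {K : Type*} [Field K]

theorem uqint_eq_qint (x : Kˣ) (k : ℤ) : uqint x k = qint (x : K) k := by
  simp [uqint, qint]

theorem qpart_eq (x : K) (k : ℤ) {m : ℕ} (ν : m.Partition) :
    qpart x k ν = (ν.parts.map fun i : ℕ => qint x (k * (i : ℤ))).prod := by
  have h : (do let a ← ν.parts; pure (a : ℤ) : Multiset ℤ) = ν.parts.map (fun a : ℕ => (a : ℤ)) :=
    Multiset.bind_singleton _ _
  rw [qpart, h, Multiset.map_map]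
  rfl

/-- The number of factors `M = nτ` varies with `n`: each `n` has its own series, of which only the
`n`-th coefficient is used. -/
theorem Zfun_eq [CharZero K] (τ n : ℕ) (hτ : 0 < τ) (x y : Kˣ)
    (hx : ∀ k : ℕ, 0 < k → uqint x k ≠ 0) :
    Zfun (τ : ℤ) n (x : K) y
      = (-1) ^ (n * τ) * unknotCoeff (n * τ) n x y / (uqint x n * uqint x (n * τ)) := by
  set p : ℕ → K := fun k => symGeom (n * τ) x k * uqint y k with hp
  have h1 : unknotCoeff (n * τ) n x y
      = ∑ ν : n.Partition, 1 / (zee ν : K) * (ν.parts.map p).prod :=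
    (isNewton_unknotCoeff (n * τ) x y).unique (isNewton_sum_partition (by simp [uqint])) n
  have h2 : ∀ ν : n.Partition, (ν.parts.map p).prod
      = qpart (x : K) (n * τ) ν * (qpart (y : K) 1 ν / qpart (x : K) 1 ν) := by
    intro ν
    rw [qpart_eq, qpart_eq, qpart_eq, ← Multiset.prod_map_div, ← Multiset.prod_map_mul]
    congr 1
    refine Multiset.map_congr rfl fun k hk => ?_
    have hk' := hx k (ν.parts_pos hk)
    have := symGeom_mul_uqint (n * τ) x k
    rw [one_mul, ← uqint_eq_qint, ← uqint_eq_qint, ← uqint_eq_qint, hp]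
    simp only
    rw [eq_div_of_mul_eq hk' this]
    push_cast
    ring
  rw [Zfun, h1, mul_div_assoc, ← Nat.cast_mul, zpow_natCast, sum_div]
  congr 1
  refine sum_congr rfl fun ν _ => ?_
  rw [framingQuot, if_neg (by exact_mod_cast hτ.ne'), h2, uqint_eq_qint, uqint_eq_qint,
    div_div, mul_comm (qint _ (n * τ : ℤ)), Nat.cast_mul]
  ring

/-- Since `{r}_{q^e} = {er}`, all summands share the denominator `{m}{mτ}`. -/
theorem gfun_eq [CharZero K] (τ m : ℕ) (hτ : 0 < τ) (x y : Kˣ)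
    (hx : ∀ k : ℕ, 0 < k → uqint x k ≠ 0) :
    gfun (τ : ℤ) m (x : K) y = lmovNum τ m x y / (uqint x m * uqint x (m * τ)) := by
  rw [gfun, lmovNum, sum_div]
  refine sum_congr rfl fun e he => ?_
  obtain ⟨⟨r, rfl⟩, hm⟩ := Nat.mem_divisors.1 he
  have he0 : 0 < e := Nat.pos_of_ne_zero (by rintro rfl; simp at hm)
  rw [Nat.mul_div_cancel_left _ he0, ← Units.val_pow_eq_pow_val, ← Units.val_pow_eq_pow_val,
    Zfun_eq τ r hτ, uqint_pow, uqint_pow, mul_div_assoc]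
  · push_cast; ring_nf
  · intro k hk
    rw [uqint_pow]
    exact_mod_cast hx (e * k) (Nat.mul_pos he0 hk)

theorem qint_neg (x : K) (k : ℤ) : qint x (-k) = - qint x k := by
  rw [qint, qint, neg_neg, neg_sub]

theorem qint_inv (x : K) (k : ℤ) : qint x⁻¹ k = - qint x k := by
  rw [qint, qint, inv_zpow', inv_zpow', neg_neg, neg_sub]

/-- Each part contributes two signs, from `-τ` and from `y⁻¹`, which cancel; the sign left over
comes from `{mτ}` in the denominator. -/
theorem gfun_neg (τ : ℤ) (hτ : τ ≠ 0) (m : ℕ) (x y : K) :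
    gfun τ m x y = - gfun (-τ) m x y⁻¹ := by
  rw [gfun, gfun, ← sum_neg_distrib]
  refine sum_congr rfl fun e _ => ?_
  rw [← mul_neg, Zfun, Zfun, ← mul_neg, ← sum_neg_distrib, mul_neg ((m / e : ℕ) : ℤ), zpow_neg,
    ← inv_zpow, inv_neg_one]
  congr 2
  refine sum_congr rfl fun ν _ => ?_
  have h1 : ∀ (z w : K) (k l : ℤ), qpart z (-k) ν * qpart w⁻¹ l ν = qpart z k ν * qpart w l ν := by
    intro z w k l
    rw [qpart, qpart, qpart, qpart, ← Multiset.prod_map_mul, ← Multiset.prod_map_mul]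
    congr 1
    refine Multiset.map_congr rfl fun i _ => ?_
    rw [neg_mul, qint_neg, qint_inv]; ring
  have h2 := h1 (x ^ e) (y ^ e) ((m / e : ℕ) * τ) 1
  rw [framingQuot, framingQuot, if_neg hτ, if_neg (neg_ne_zero.2 hτ), inv_pow, mul_neg, qint_neg]
  calc _ = 1 / (zee ν : K) * (qpart (x ^ e) ((m / e : ℕ) * τ) ν * qpart (y ^ e) 1 ν) /
        (qint (x ^ e) ((m / e : ℕ) * τ) * qint (x ^ e) (m / e : ℕ) * qpart (x ^ e) 1 ν) := by
        simp only [div_eq_mul_inv, mul_inv]; ring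
    _ = _ := by
        rw [← h2]
        simp only [div_eq_mul_inv, mul_inv, inv_neg]; ring

/-- Only `ν = (n)` contributes to `𝒵_n`, so `𝒵_{m/e}(q^e, a^e)` does not depend on `e` and the sum
of `μ` over the divisors of `m` remains. -/
theorem gfun_zero [CharZero K] (m : ℕ) (hm : 0 < m) (x y : K) :
    gfun 0 m x y = if m = 1 then qint y 1 / qint x 1 ^ 2 else 0 := by
  have hZ : ∀ n : ℕ, 0 < n → ∀ x y : K, Zfun 0 n x y = qint y n / qint x n ^ 2 := by
    intro n hn x y
    have h0 : ((Nat.Partition.indiscrete n).parts : Multiset ℕ) = {n} :=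
      Nat.Partition.indiscrete_parts hn.ne'
    have hn' : (n : K) ≠ 0 := by exact_mod_cast hn.ne'
    rw [Zfun, Fintype.sum_eq_single (Nat.Partition.indiscrete n)]
    · simp only [framingQuot, zee, qpart, h0]
      simp
      field_simp
    · intro ν hν
      have : ν.parts ≠ {n} := fun h => hν (Nat.Partition.ext (h.trans h0.symm))
      simp [framingQuot, this]
  have h1 : ∀ e ∈ m.divisors, (ArithmeticFunction.moebius e : K) * Zfun 0 (m / e) (x ^ e) (y ^ e)
      = (ArithmeticFunction.moebius e : K) * (qint y m / qint x m ^ 2) := by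
    intro e he
    obtain ⟨⟨r, rfl⟩, hm⟩ := Nat.mem_divisors.1 he
    have he0 : 0 < e := Nat.pos_of_ne_zero (by rintro rfl; simp at hm)
    have hr0 : 0 < r := Nat.pos_of_ne_zero (by rintro rfl; simp at hm)
    rw [Nat.mul_div_cancel_left _ he0, hZ r hr0]
    have : ∀ z : K, qint (z ^ e) r = qint z (e * r : ℕ) := by
      intro z
      simp only [qint, ← zpow_natCast, ← zpow_mul, Nat.cast_mul, mul_neg]
    rw [this, this]
  have h2 : ∑ e ∈ m.divisors, ArithmeticFunction.moebius e = if m = 1 then 1 else 0 := by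
    rw [← ArithmeticFunction.coe_mul_zeta_apply, ArithmeticFunction.moebius_mul_coe_zeta,
      ArithmeticFunction.one_apply]
  rw [gfun, sum_congr rfl h1, ← sum_mul, ← Int.cast_sum, h2]
  split_ifs with h
  · subst h; simp
  · simp

end

end UnknotLMOV

end

noncomputable section

namespace UnknotLMOV

open Finset

/-! ### Vanishing at roots of unity -/

/-- On squarefree divisors, `e ↔ pe` is an involution that reverses the sign of `μ`. -/
theorem sum_moebius_mul_eq_zero {R : Type*} [CommRing R] {m p : ℕ} (hm : m ≠ 0) (hp : p.Prime)
    (hpm : p ∣ m) (F : ℕ → R) (hF : ∀ e, ¬ p ∣ e → p * e ∣ m → F (p * e) = F e) :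
    ∑ e ∈ m.divisors, (ArithmeticFunction.moebius e : R) * F e = 0 := by
  classical
  have hs : ∑ e ∈ m.divisors, (ArithmeticFunction.moebius e : R) * F e
      = ∑ e ∈ m.divisors with Squarefree e, (ArithmeticFunction.moebius e : R) * F e := by
    rw [sum_filter]
    refine sum_congr rfl fun e _ => ?_
    split_ifs with h
    · rfl
    · rw [ArithmeticFunction.moebius_eq_zero_of_not_squarefree h]; simp
  have hsq : ∀ e, ¬ p ∣ e → Squarefree e → Squarefree (p * e) := fun e h h' =>
    (Nat.squarefree_mul ((Nat.Prime.coprime_iff_not_dvd hp).2 h)).2 ⟨hp.squarefree, h'⟩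
  have hmu : ∀ e, ¬ p ∣ e →
      (ArithmeticFunction.moebius (p * e) : R) = - ArithmeticFunction.moebius e := by
    intro e h
    rw [ArithmeticFunction.isMultiplicative_moebius.map_mul_of_coprime
      ((Nat.Prime.coprime_iff_not_dvd hp).2 h), ArithmeticFunction.moebius_apply_prime hp]
    simp
  have hnd : ∀ e, Squarefree (p * e) → ¬ p ∣ e := by
    rintro e h ⟨c, rfl⟩
    refine hp.one_lt.ne' ?_
    have := h p ⟨c, by ring⟩
    exact Nat.isUnit_iff.1 this
  have hdiv : ∀ e, ¬ p ∣ e → e ∣ m → p * e ∣ m := fun e h h' =>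
    ((Nat.Prime.coprime_iff_not_dvd hp).2 h).mul_dvd_of_dvd_of_dvd hpm h'
  rw [hs]
  refine sum_involution (fun e _ => if p ∣ e then e / p else p * e) ?_ ?_ ?_ ?_
  · intro e he
    simp only [mem_filter, Nat.mem_divisors] at he
    split_ifs with h
    · obtain ⟨c, rfl⟩ := h
      have hc := hnd c he.2
      rw [Nat.mul_div_cancel_left _ hp.pos, hmu c hc, hF c hc he.1.1]; ring
    · rw [hmu e h, hF e h (hdiv e h he.1.1)]; ring
  · intro e he _
    simp only [mem_filter, Nat.mem_divisors] at he
    have he0 : e ≠ 0 := he.2.ne_zero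
    split_ifs with h
    · exact (Nat.div_lt_self (Nat.pos_of_ne_zero he0) hp.one_lt).ne
    · intro h'
      exact h ⟨e, h'.symm⟩ |>.elim
  · intro e he
    simp only [mem_filter, Nat.mem_divisors] at he ⊢
    split_ifs with h
    · obtain ⟨c, rfl⟩ := h
      rw [Nat.mul_div_cancel_left _ hp.pos]
      exact ⟨⟨(Dvd.intro_left p rfl).trans he.1.1, hm⟩, he.2.squarefree_of_dvd (Dvd.intro_left p rfl)⟩
    · exact ⟨⟨hdiv e h he.1.1, hm⟩, hsq e h he.2⟩
  · intro e he
    simp only [mem_filter, Nat.mem_divisors] at he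
    by_cases h : p ∣ e
    · obtain ⟨c, rfl⟩ := h
      have hc := hnd c he.2
      simp only [dvd_mul_right, if_true, Nat.mul_div_cancel_left _ hp.pos, hc, if_false]
    · simp only [h, if_false, dvd_mul_right, if_true, Nat.mul_div_cancel_left _ hp.pos]

/-! ### First-order neighbourhoods of roots of unity. -/

open DualNumber

/-- Complex units as units of the dual numbers. -/
def inlUnit : ℂˣ →* (ℂ[ε])ˣ := Units.map (TrivSqZeroExt.inlHom ℂ ℂ : ℂ →* ℂ[ε])

/-- The unit `1 + ε`. -/
def etaUnit : (ℂ[ε])ˣ where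
  val := 1 + ε
  inv := 1 - ε
  val_inv := by ring_nf; rw [pow_two, DualNumber.eps_mul_eps]; ring
  inv_val := by ring_nf; rw [pow_two, DualNumber.eps_mul_eps]; ring

theorem etaUnit_zpow (k : ℤ) : ((etaUnit ^ k : (ℂ[ε])ˣ) : ℂ[ε]) = 1 + (k : ℂ[ε]) * ε := by
  have hε : (ε * ε : ℂ[ε]) = 0 := DualNumber.eps_mul_eps
  induction k using Int.induction_on with
  | zero => simp
  | succ n ih =>
    rw [zpow_add_one, Units.val_mul, ih, show (etaUnit : ℂ[ε]) = 1 + ε from rfl]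
    push_cast
    linear_combination (n : ℂ[ε]) * hε
  | pred n ih =>
    rw [zpow_sub_one, Units.val_mul, ih, show ((etaUnit⁻¹ : (ℂ[ε])ˣ) : ℂ[ε]) = 1 - ε from rfl]
    push_cast
    linear_combination (n : ℂ[ε]) * hε

/-- The point `ζ (1 + ε)` infinitely near to `ζ`. -/
def nearUnit (ζ : ℂˣ) : (ℂ[ε])ˣ := inlUnit ζ * etaUnit

/-- Reduction modulo `ε`. -/
def redHom : ℂ[ε] →+* ℂ := (TrivSqZeroExt.fstHom ℂ ℂ ℂ).toRingHom

theorem map_redHom_inlUnit (ζ : ℂˣ) : Units.map (redHom : ℂ[ε] →* ℂ) (inlUnit ζ) = ζ := by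
  ext; rfl

theorem map_redHom_nearUnit (ζ : ℂˣ) : Units.map (redHom : ℂ[ε] →* ℂ) (nearUnit ζ) = ζ := by
  ext
  simp [nearUnit, inlUnit, etaUnit, redHom]

theorem map_symGeom {R S : Type*} [CommRing R] [CommRing S] (f : R →+* S) (M : ℕ) (x : Rˣ) (k : ℕ) :
    f (symGeom M x k) = symGeom M (Units.map (f : R →* S) x) k := by
  simp only [symGeom, map_sum, ← map_zpow]
  rfl

/-- At `ζ` the quotient `{kM}/{k}` has vanishing numerator and nonvanishing denominator. -/
theorem redHom_symGeom (ζ : ℂˣ) (M k : ℕ) (h1 : (ζ ^ 2) ^ k ≠ 1) (h2 : (ζ ^ 2) ^ (M * k) = 1) :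
    redHom (symGeom M (nearUnit ζ) k) = 0 := by
  rw [map_symGeom, map_redHom_nearUnit]
  have h3 := symGeom_mul_uqint M ζ k
  have h4 : ∀ n : ℕ, (uqint ζ n : ℂ) = ((ζ ^ (-(n : ℤ)) : ℂˣ) : ℂ) * ((((ζ ^ 2) ^ n : ℂˣ) : ℂ) - 1) := by
    intro n
    rw [uqint, mul_sub, ← Units.val_mul, mul_one, ← pow_mul, ← zpow_natCast ζ (2 * n), ← zpow_add]
    congr 4
    push_cast; ring
  rw [← Nat.cast_mul, h4, h4, h2, Units.val_one, sub_self, mul_zero, mul_eq_zero, mul_eq_zero] at h3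
  rcases h3 with h3 | h3 | h3
  · exact h3
  · exact absurd h3 (Units.ne_zero _)
  · exact absurd (Units.ext (sub_eq_zero.1 h3)) h1

theorem sum_range_sub_two_mul (M : ℕ) : ∑ j ∈ range M, ((M : ℤ) - 1 - 2 * j) = 0 := by
  have h : ∀ N : ℕ, ∑ j ∈ range N, ((M : ℤ) - 1 - 2 * j) = N * (M - N) := by
    intro N
    induction N with
    | zero => simp
    | succ n ih => rw [sum_range_succ, ih]; push_cast; ring
  rw [h]; ring

/-- All terms have the same value at `ζ`, because their exponents differ by multiples of `2k`. The
`ε`-terms cancel because the exponents sum to zero. -/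
theorem symGeom_nearUnit (ζ : ℂˣ) (M k : ℕ) (h1 : (ζ ^ 2) ^ k = 1) :
    symGeom M (nearUnit ζ) k = M * ((inlUnit ζ ^ (k * (M + 1)) : (ℂ[ε])ˣ) : ℂ[ε]) := by
  have h2 : ∀ j : ℕ, ((nearUnit ζ ^ ((k : ℤ) * ((M : ℤ) - 1 - 2 * j)) : (ℂ[ε])ˣ) : ℂ[ε])
      = ((inlUnit ζ ^ (k * (M + 1)) : (ℂ[ε])ˣ) : ℂ[ε])
        * (1 + (k : ℂ[ε]) * (((M : ℤ) - 1 - 2 * j : ℤ) : ℂ[ε]) * ε) := by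
    intro j
    rw [nearUnit, (Commute.all (inlUnit ζ) etaUnit).mul_zpow, Units.val_mul, etaUnit_zpow]
    congr 2
    · rw [← map_zpow, ← map_pow]
      congr 1
      rw [show (k : ℤ) * ((M : ℤ) - 1 - 2 * j) = ((k * (M + 1) : ℕ) : ℤ) + ((2 * k : ℕ) : ℤ) * (-1 - j) by
        push_cast; ring, zpow_add, zpow_natCast, zpow_mul, zpow_natCast, pow_mul ζ 2 k, h1, one_zpow,
        mul_one]
    · push_cast; ring
  rw [symGeom, sum_congr rfl fun j _ => h2 j, ← mul_sum, sum_add_distrib, ← sum_mul, ← mul_sum,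
    ← Int.cast_sum, sum_range_sub_two_mul]
  simp [mul_comm]

theorem redHom_mul_eq_zero (a b : ℂ[ε]) (ha : redHom a = 0) (hb : redHom b = 0) : a * b = 0 := by
  have ha' : a.fst = 0 := ha
  have hb' : b.fst = 0 := hb
  ext
  · simp [ha']
  · simp [ha', hb']

section

variable (ζ y : ℂˣ) (e M : ℕ) (hM : (ζ ^ 2) ^ (e * M) = 1)
include hM

theorem redHom_newton (k : ℕ) (hk : ¬ orderOf ((ζ ^ 2) ^ e) ∣ k) :
    symGeom M (nearUnit ζ ^ e) k * uqint (inlUnit y ^ e) k ∈ RingHom.ker redHom := by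
  refine Ideal.mul_mem_right _ _ ?_
  rw [RingHom.mem_ker, symGeom_pow]
  refine redHom_symGeom ζ M (e * k) ?_ ?_
  · rwa [orderOf_dvd_iff_pow_eq_one, ← pow_mul] at hk
  · rw [show M * (e * k) = e * M * k by ring, pow_mul, hM, one_pow]

theorem redHom_unknotCoeff (n : ℕ) (hn : ¬ orderOf ((ζ ^ 2) ^ e) ∣ n) :
    redHom (unknotCoeff M n (nearUnit ζ ^ e) (inlUnit y ^ e)) = 0 :=
  (isNewton_unknotCoeff M (nearUnit ζ ^ e) (inlUnit y ^ e)).mem_of_not_dvd (RingHom.ker redHom)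
    (redHom_newton ζ y e M hM) n hn

end

/-- The kernel of `redHom` has square zero and contains the power sums of index not divisible by
`d`, so `comp_mul` applies. The remaining ones, divided by `d`, are those of the series with `M'`
factors at `x = 1`, scaled by a power of `ζ`. Thus the right side has no `ε`-part. -/
theorem unknotCoeff_nearUnit (ζ y : ℂˣ) (e M : ℕ) (hM : (ζ ^ 2) ^ (e * M) = 1) (d : ℕ)
    (hd : orderOf ((ζ ^ 2) ^ e) = d) (hd0 : 0 < d) (M' r : ℕ) (hM' : M = d * M') :
    unknotCoeff M (d * r) (nearUnit ζ ^ e) (inlUnit y ^ e)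
      = ((inlUnit ζ ^ (e * (d * r) * (M + 1)) : (ℂ[ε])ˣ) : ℂ[ε])
        * unknotCoeff M' r 1 (inlUnit y ^ (e * d)) := by
  set s : ℂ[ε] := ((inlUnit ζ ^ (e * d * (M + 1)) : (ℂ[ε])ˣ) : ℂ[ε]) with hs
  have h1 := (isNewton_unknotCoeff M' 1 (inlUnit y ^ (e * d))).scale s
  have h2 := (isNewton_unknotCoeff M (nearUnit ζ ^ e) (inlUnit y ^ e)).comp_mul
    (RingHom.ker redHom) (fun a ha b hb => redHom_mul_eq_zero a b ha hb) hd0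
    (fun k hk => redHom_newton ζ y e M hM k (hd ▸ hk))
    (p' := fun k => s ^ k * (symGeom M' 1 k * uqint (inlUnit y ^ (e * d)) k)) (fun k => by
      have h3 : (ζ ^ 2) ^ (e * (d * k)) = 1 := by
        rw [pow_mul, ← orderOf_dvd_iff_pow_eq_one, hd]; exact dvd_mul_right _ _
      rw [symGeom_pow, symGeom_nearUnit ζ M _ h3, uqint_pow, uqint_pow, hs,
        ← Units.val_pow_eq_pow_val, ← pow_mul,
        show e * d * (M + 1) * k = e * (d * k) * (M + 1) by ring, hM']
      simp only [symGeom, one_zpow, Units.val_one, sum_const, card_range, nsmul_eq_mul, mul_one]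
      push_cast
      ring_nf)
  have h4 := h2.unique h1 r
  rw [h4, hs, ← Units.val_pow_eq_pow_val, ← pow_mul]
  congr 3
  ring

theorem lmovNum_nearUnit (ζ y : ℂˣ) (τ m : ℕ) (hm : 0 < m) (h1 : ζ ^ 2 ≠ 1) (h2 : (ζ ^ 2) ^ m = 1) :
    lmovNum τ m (nearUnit ζ) (inlUnit y) = 0 := by
  set d := orderOf (ζ ^ 2) with hd
  have hdm : d ∣ m := orderOf_dvd_of_pow_eq_one h2
  have hd0 : 0 < d := Nat.pos_of_dvd_of_pos hdm hm
  have hd1 : d ≠ 1 := fun h => h1 (orderOf_eq_one_iff.1 h)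
  obtain ⟨p, hp, hpd⟩ := Nat.exists_prime_and_dvd hd1
  -- `σ` joins the framing sign to the power of `ζ` from `unknotCoeff_nearUnit`, whose exponent is
  -- `m((m/e)τ + 1)`. Apart from the power of `σ`, `F e` depends on `e` only through `lcm(d, e)`.
  set σ : (ℂ[ε])ˣ := - inlUnit ζ ^ m with hσ
  set F : ℕ → ℂ[ε] := fun e => ((σ ^ (m / e * τ) * inlUnit ζ ^ m : (ℂ[ε])ˣ) : ℂ[ε]) *
    unknotCoeff (m / Nat.lcm d e * τ) (m / Nat.lcm d e) 1 (inlUnit y ^ Nat.lcm d e) with hF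
  have hterm : ∀ e ∈ m.divisors, (-1) ^ (m / e * τ) *
      unknotCoeff (m / e * τ) (m / e) (nearUnit ζ ^ e) (inlUnit y ^ e) = F e := by
    intro e he
    obtain ⟨hem, hm0⟩ := Nat.mem_divisors.1 he
    have he0 : 0 < e := Nat.pos_of_dvd_of_pos hem hm
    obtain ⟨r, hr⟩ := Nat.lcm_dvd hdm hem
    have hl : Nat.lcm d e = e * (d / Nat.gcd d e) := by
      rw [Nat.lcm, mul_comm d e, Nat.mul_div_assoc _ (Nat.gcd_dvd_left d e)]
    set d' := d / Nat.gcd d e with hd'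
    have hd'0 : 0 < d' := Nat.div_pos (Nat.gcd_le_left _ hd0) (Nat.gcd_pos_of_pos_left _ hd0)
    have hme : m / e = d' * r := by
      rw [hr, hl, mul_assoc, Nat.mul_div_cancel_left _ he0]
    have hml : m / Nat.lcm d e = r := by
      rw [hr, Nat.mul_div_cancel_left _ (Nat.lcm_pos hd0 he0)]
    -- `d' = d / gcd(d, e)` is the order of `ζ^{2e}`.
    have key := unknotCoeff_nearUnit ζ y e (d' * r * τ) (by
      rw [← hme, ← mul_assoc, Nat.mul_div_cancel' hem, pow_mul, h2, one_pow]) d'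
      (orderOf_pow' _ he0.ne') hd'0 (r * τ) r (by ring)
    rw [hF]
    simp only
    rw [hml, hme, key, ← hl, ← hme, Nat.mul_div_cancel' hem, ← mul_assoc]
    congr 1
    rw [hσ, neg_pow, mul_add, pow_add, mul_one, pow_mul (inlUnit ζ) m]
    push_cast
    ring
  rw [lmovNum, sum_congr rfl fun e he => by rw [hterm e he]]
  refine sum_moebius_mul_eq_zero hm.ne' hp (hpd.trans hdm) F fun e hpe hdiv => ?_
  have hlcm : Nat.lcm d (p * e) = Nat.lcm d e := by
    refine Nat.dvd_antisymm (Nat.lcm_dvd (Nat.dvd_lcm_left _ _) ?_)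
      (Nat.lcm_dvd (Nat.dvd_lcm_left _ _) ((Dvd.intro_left p rfl).trans (Nat.dvd_lcm_right _ _)))
    exact ((Nat.Prime.coprime_iff_not_dvd hp).2 hpe).mul_dvd_of_dvd_of_dvd
      (hpd.trans (Nat.dvd_lcm_left _ _)) (Nat.dvd_lcm_right _ _)
  rw [hF]
  simp only
  rw [hlcm]
  congr 3
  obtain ⟨r, hr⟩ := hdiv
  have he0 : 0 < e := Nat.pos_of_ne_zero (by rintro rfl; simp at hpe)
  have hm1 : m / (p * e) = r := by rw [hr, Nat.mul_div_cancel_left _ (Nat.mul_pos hp.pos he0)]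
  have hm2 : m / e = p * r := by
    rw [hr, show p * e * r = e * (p * r) by ring, Nat.mul_div_cancel_left _ he0]
  rw [hm1, hm2]
  have hσ2 : σ ^ 2 = 1 := by
    rw [hσ, neg_sq, ← pow_mul, mul_comm m 2, pow_mul, ← map_pow, ← map_pow, h2, map_one]
  -- It remains to compare `σ^{prτ}` with `σ^{rτ}`, where `σ² = 1`. For odd `p` the exponents have
  -- equal parity. For `p = 2` one needs `σ^r = 1`: as `ζ^d = -1`, `ζ^m = (-1)^b` with `m = db`. If
  -- `b` is odd, then `σ = 1`; if `b` is even, then `r` is even because `e` is odd.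
  rcases hp.eq_two_or_odd' with rfl | hodd
  · suffices h : σ ^ r = 1 by
      rw [mul_assoc, pow_mul σ 2, hσ2, one_pow, pow_mul, h, one_pow]
    have hζm : (ζ ^ m) ^ 2 = 1 := by rw [← pow_mul, mul_comm, pow_mul, h2]
    obtain ⟨c, hc⟩ := hpd
    have hζd : ζ ^ d = -1 := by
      have h3 : (ζ ^ d) ^ 2 = 1 := by rw [← pow_mul, mul_comm, pow_mul, pow_orderOf_eq_one]
      have h4 : ((ζ ^ d : ℂˣ) : ℂ) ^ 2 = 1 := by rw [← Units.val_pow_eq_pow_val, h3, Units.val_one]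
      rw [sq] at h4
      rcases mul_self_eq_one_iff.1 h4 with h5 | h5
      · exfalso
        have h6 : (ζ ^ 2) ^ c = 1 := by rw [← pow_mul, ← hc]; exact Units.ext h5
        have := Nat.le_of_dvd (by omega) (orderOf_dvd_of_pow_eq_one h6)
        omega
      · exact Units.ext h5
    obtain ⟨b, hb⟩ := hdm
    have hζm' : ζ ^ m = (-1) ^ b := by rw [hb, pow_mul, hζd]
    rcases Nat.even_or_odd b with hbe | hbo
    · have : Even r := by
        obtain ⟨b', rfl⟩ := hbe
        have h7 : e * r = 2 * (c * b') := by
          have : 2 * (e * r) = 2 * (2 * (c * b')) := by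
            rw [← mul_assoc, ← hr, hb, hc]; ring
          omega
        rcases (Nat.Prime.dvd_mul Nat.prime_two).1 (Dvd.intro _ h7.symm) with h8 | h8
        · exact absurd h8 hpe
        · exact even_iff_two_dvd.2 h8
      obtain ⟨r', rfl⟩ := this
      rw [← two_mul, pow_mul, hσ2, one_pow]
    · have : σ = 1 := by
        rw [hσ, ← map_pow, hζm', hbo.neg_one_pow]
        ext <;> simp [inlUnit]
      rw [this, one_pow]
  · obtain ⟨c, rfl⟩ := hodd
    rw [show (2 * c + 1) * r * τ = 2 * (c * r * τ) + r * τ by ring, pow_add, pow_mul σ 2, hσ2,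
      one_pow, one_mul]

/-- Each summand vanishes by itself: the order of `ζ^{2e}` does not divide `m/e`, since `ζ^{2m} ≠
1`. -/
theorem lmovNum_eq_zero (ζ y : ℂˣ) (τ m : ℕ) (h1 : (ζ ^ 2) ^ m ≠ 1) (h2 : (ζ ^ 2) ^ (m * τ) = 1) :
    lmovNum τ m (ζ : ℂˣ) y = 0 := by
  have h : redHom (lmovNum τ m (nearUnit ζ) (inlUnit y)) = 0 := by
    rw [lmovNum, map_sum]
    refine sum_eq_zero fun e he => ?_
    obtain ⟨hem, hm0⟩ := Nat.mem_divisors.1 he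
    rw [map_mul, map_mul, redHom_unknotCoeff, mul_zero, mul_zero]
    · rw [← mul_assoc, Nat.mul_div_cancel' hem, h2]
    · rw [orderOf_dvd_iff_pow_eq_one, ← pow_mul, Nat.mul_div_cancel' hem]
      exact h1
  rwa [map_lmovNum, map_redHom_nearUnit, map_redHom_inlUnit] at h

end UnknotLMOV

end

noncomputable section

namespace UnknotLMOV

open LaurentPolynomial

/-! ### Divisibility -/

theorem rootMultiplicity_X_pow_sub_one {n : ℕ} (hn : 0 < n) (a : ℂ) :
    (Polynomial.X ^ n - 1 : Polynomial ℂ).rootMultiplicity a ≤ if a ^ n = 1 then 1 else 0 := by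
  split_ifs with h
  · rw [← Polynomial.count_roots]
    refine Multiset.nodup_iff_count_le_one.1 (Polynomial.nodup_roots ?_) a
    have := Polynomial.separable_X_pow_sub_C (1 : ℂ) (n := n) (by exact_mod_cast hn.ne') one_ne_zero
    simpa using this
  · rw [Polynomial.rootMultiplicity_eq_zero]
    simpa [Polynomial.IsRoot, sub_eq_zero] using h

/-- Root multiplicities are compared. Each factor on the left has simple roots; the square pays for
`±1`, a double root of `P` for the other roots of `X^{2m} - 1`, and a simple root for those of
`X^{2M} - 1` alone. -/
theorem mul_dvd_sq_mul {m M : ℕ} (hm : 0 < m) (hM : 0 < M) (P : Polynomial ℂ)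
    (h1 : ∀ ζ : ℂ, ζ ^ (2 * m) ≠ 1 → ζ ^ (2 * M) = 1 → P.eval ζ = 0)
    (h2 : ∀ ζ : ℂ, ζ ^ 2 ≠ 1 → ζ ^ (2 * m) = 1 → P.eval ζ = 0 ∧ P.derivative.eval ζ = 0) :
    (Polynomial.X ^ (2 * m) - 1 : Polynomial ℂ) * (Polynomial.X ^ (2 * M) - 1)
      ∣ (Polynomial.X ^ 2 - 1) ^ 2 * P := by
  rcases eq_or_ne P 0 with rfl | hP
  · simp
  have hX : ∀ n : ℕ, 0 < n → (Polynomial.X ^ n - 1 : Polynomial ℂ) ≠ 0 := fun n hn =>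
    (Polynomial.monic_X_pow_sub_C (1 : ℂ) hn.ne').ne_zero
  have hl := mul_ne_zero (hX (2 * m) (by omega)) (hX (2 * M) (by omega))
  have hr := mul_ne_zero (pow_ne_zero 2 (hX 2 (by omega))) hP
  rw [IsAlgClosed.dvd_iff_roots_le_roots hl hr, Multiset.le_iff_count]
  intro a
  rw [Polynomial.count_roots, Polynomial.count_roots, Polynomial.rootMultiplicity_mul hl,
    Polynomial.rootMultiplicity_mul hr]
  have e1 := rootMultiplicity_X_pow_sub_one (n := 2 * m) (by omega) a
  have e2 := rootMultiplicity_X_pow_sub_one (n := 2 * M) (by omega) a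
  by_cases ha : a ^ 2 = 1
  · have : 2 ≤ Polynomial.rootMultiplicity a ((Polynomial.X ^ 2 - 1 : Polynomial ℂ) ^ 2) := by
      rw [Polynomial.le_rootMultiplicity_iff (pow_ne_zero 2 (hX 2 (by omega)))]
      refine pow_dvd_pow_of_dvd (Polynomial.dvd_iff_isRoot.2 ?_) 2
      simp [ha]
    split_ifs at e1 e2
    all_goals omega
  by_cases ha2 : a ^ (2 * m) = 1
  · have := (Polynomial.one_lt_rootMultiplicity_iff_isRoot hP).2
      (show P.IsRoot a ∧ P.derivative.IsRoot a from h2 a ha ha2)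
    split_ifs at e1 e2 <;> omega
  by_cases ha3 : a ^ (2 * M) = 1
  · have := (Polynomial.rootMultiplicity_pos hP).2 (show P.IsRoot a from h1 a ha2 ha3)
    rw [if_neg ha2] at e1
    split_ifs at e2
    all_goals omega
  · rw [if_neg ha2] at e1
    rw [if_neg ha3] at e2
    omega

/-! ### Integral divisibility of the numerator in two variables. -/

/-- The variable of a ring of Laurent polynomials, as a unit. -/
def tUnit (R : Type*) [CommRing R] : (R[T;T⁻¹])ˣ where
  val := T 1
  inv := T (-1)
  val_inv := by rw [← T_add]; simp
  inv_val := by rw [← T_add]; simp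

theorem tUnit_zpow {R : Type*} [CommRing R] (n : ℤ) :
    ((tUnit R ^ n : (R[T;T⁻¹])ˣ) : R[T;T⁻¹]) = T n := by
  induction n using Int.induction_on with
  | zero => simp
  | succ n ih => rw [zpow_add_one, Units.val_mul, ih, T_add]; rfl
  | pred n ih => rw [zpow_sub_one, Units.val_mul, ih, T_sub]; rfl

theorem uqint_tUnit {R : Type*} [CommRing R] (k : ℤ) : uqint (tUnit R) k = T k - T (-k) := by
  rw [uqint, tUnit_zpow, tUnit_zpow]

theorem uqint_tUnit_ne_zero {R : Type*} [CommRing R] [Nontrivial R] (k : ℤ) (hk : 0 < k) :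
    uqint (tUnit R) k ≠ 0 := by
  rw [uqint_tUnit]
  intro h
  have h1 := congrArg (fun f : R[T;T⁻¹] => f.coeff k) h
  have h2 : -k ≠ k := by omega
  simp [h2] at h1

/-- The ring `ℤ[y, y⁻¹]`. -/
abbrev CoeffRing : Type := LaurentPolynomial ℤ

/-- The unit `y` of `ℤ[y, y⁻¹][x, x⁻¹]`. -/
def yUnit : (CoeffRing[T;T⁻¹])ˣ := Units.map ((LaurentPolynomial.C : CoeffRing →+* CoeffRing[T;T⁻¹]) : CoeffRing →* CoeffRing[T;T⁻¹]) (tUnit ℤ)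

/-- The numerator of `g_m` as a Laurent polynomial in two variables. -/
def univNum (τ m : ℕ) : CoeffRing[T;T⁻¹] := lmovNum τ m (tUnit CoeffRing) yUnit

/-- Evaluation of Laurent polynomials in two variables. -/
def evalTwo {R : Type*} [CommRing R] (x y : Rˣ) : CoeffRing[T;T⁻¹] →+* R :=
  eval₂ (eval₂ (Int.castRingHom R) y) x

theorem map_evalTwo_x {R : Type*} [CommRing R] (x y : Rˣ) :
    Units.map (evalTwo x y : _ →* R) (tUnit CoeffRing) = x := by
  ext
  change evalTwo x y (T 1) = x
  rw [evalTwo, eval₂_T, zpow_one]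

theorem map_evalTwo_y {R : Type*} [CommRing R] (x y : Rˣ) :
    Units.map (evalTwo x y : _ →* R) yUnit = y := by
  ext
  change evalTwo x y (C (T 1)) = y
  rw [evalTwo, eval₂_C, eval₂_T, zpow_one]

theorem evalTwo_univNum {R : Type*} [CommRing R] (τ m : ℕ) (x y : Rˣ) :
    evalTwo x y (univNum τ m) = lmovNum τ m x y := by
  rw [univNum, map_lmovNum, map_evalTwo_x, map_evalTwo_y]

/-- A transcendental value of `y` embeds `ℤ[y, y⁻¹]` in `ℂ`, where divisibility can be read off from
roots. -/
theorem exists_injective_eval : ∃ y : ℂˣ, Function.Injective (eval₂ (Int.castRingHom ℂ) y) := by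
  have h1 : Transcendental ℤ ((liouvilleNumber 2 : ℝ) : ℂ) :=
    (transcendental_algebraMap_iff (R := ℤ) (S := ℝ) (A := ℂ) (algebraMap ℝ ℂ).injective).2
      (transcendental_liouvilleNumber le_rfl)
  have h0 : ((liouvilleNumber 2 : ℝ) : ℂ) ≠ 0 := fun h => h1 (h ▸ isAlgebraic_zero)
  refine ⟨Units.mk0 _ h0, ?_⟩
  rw [injective_iff_map_eq_zero]
  intro f hf
  obtain ⟨n, P, hP⟩ := exists_T_pow f
  have h2 := congrArg (eval₂ (Int.castRingHom ℂ) (Units.mk0 _ h0)) hP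
  rw [eval₂_toLaurent, map_mul, hf, zero_mul] at h2
  have h3 : P = 0 := by
    by_contra hne
    exact h1 ⟨P, hne, by rw [Polynomial.aeval_def]; exact h2⟩
  rw [h3, map_zero] at hP
  exact (isUnit_T (R := ℤ) (n : ℤ)).mul_left_eq_zero.1 hP.symm

theorem exists_quotient (τ m : ℕ) (hτ : 0 < τ) (hm : 0 < m) :
    ∃ f : CoeffRing[T;T⁻¹], uqint (tUnit CoeffRing) 1 ^ 2 * univNum τ m
      = uqint (tUnit CoeffRing) m * uqint (tUnit CoeffRing) (m * τ) * f := by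
  obtain ⟨n, P, hP⟩ := exists_T_pow (univNum τ m)
  obtain ⟨y, hy⟩ := exists_injective_eval
  set ev := eval₂ (Int.castRingHom ℂ) y with hev
  have hz : ∀ ζ : ℂˣ, lmovNum τ m ζ y = 0 → (P.map ev).eval (ζ : ℂ) = 0 := by
    intro ζ h
    have h1 := congrArg (evalTwo ζ y) hP
    rw [map_mul, evalTwo_univNum, h, zero_mul, evalTwo, eval₂_toLaurent] at h1
    rwa [Polynomial.eval_map]
  have hzz : ∀ ζ : ℂˣ, lmovNum τ m (nearUnit ζ) (inlUnit y) = 0 →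
      (P.map ev).eval (ζ : ℂ) = 0 ∧ (P.map ev).derivative.eval (ζ : ℂ) = 0 := by
    intro ζ h
    have h1 := congrArg (evalTwo (nearUnit ζ) (inlUnit y)) hP
    rw [map_mul, evalTwo_univNum, h, zero_mul, evalTwo, eval₂_toLaurent] at h1
    have halg : ∀ c : ℂ, algebraMap ℂ (DualNumber ℂ) c = TrivSqZeroExt.inl c := fun _ => rfl
    have h2 : eval₂ (Int.castRingHom (DualNumber ℂ)) (inlUnit y)
        = (algebraMap ℂ (DualNumber ℂ)).comp ev := by
      refine RingHom.ext fun f => ?_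
      induction f using LaurentPolynomial.induction_on' with
      | add p q hp hq => rw [map_add, map_add, hp, hq]
      | C_mul_T k a =>
        rw [eval₂_C_mul_T, RingHom.comp_apply, hev, eval₂_C_mul_T, map_mul, ← map_zpow inlUnit,
          eq_intCast, eq_intCast, map_intCast]
        rfl
    have h3 : ((nearUnit ζ : (DualNumber ℂ)ˣ) : DualNumber ℂ)
        = algebraMap ℂ (DualNumber ℂ) ζ + algebraMap ℂ (DualNumber ℂ) ζ * DualNumber.eps := by
      simp [nearUnit, inlUnit, etaUnit, mul_add, halg]
    -- Taylor expansion `P(ζ + ζε) = P(ζ) + ζ P'(ζ) ε`.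
    rw [h2, ← Polynomial.eval₂_map, ← Polynomial.aeval_def, h3,
      Polynomial.aeval_add_of_sq_eq_zero _ _ _ (by
        rw [mul_pow, pow_two DualNumber.eps, DualNumber.eps_mul_eps, mul_zero]),
      Polynomial.aeval_algebraMap_apply, Polynomial.aeval_algebraMap_apply] at h1
    have h4 := congrArg TrivSqZeroExt.fst h1
    have h5 := congrArg TrivSqZeroExt.snd h1
    simp only [halg] at h4 h5
    simp at h4 h5
    exact ⟨h4, by rw [Polynomial.derivative_map]; exact h5⟩
  have hne : ∀ (ζ : ℂ) (k : ℕ), 0 < k → ζ ^ k = 1 → ζ ≠ 0 := by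
    rintro _ k hk h rfl
    rw [zero_pow hk.ne'] at h
    exact zero_ne_one h
  have hM : 0 < m * τ := Nat.mul_pos hm hτ
  have hdvd := mul_dvd_sq_mul hm hM (P.map ev)
    (fun ζ h1 h2 => hz (Units.mk0 ζ (hne ζ _ (by omega) h2)) (lmovNum_eq_zero _ y τ m
      (fun h => h1 (by rw [pow_mul]; exact congrArg Units.val h))
      (by ext; rw [← pow_mul]; exact h2)))
    (fun ζ h1 h2 => hzz (Units.mk0 ζ (hne ζ _ (by omega) h2)) (lmovNum_nearUnit _ y τ m hm
      (fun h => h1 (congrArg Units.val h))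
      (by ext; rw [← pow_mul]; exact h2)))
  -- The divisor is monic, so divisibility over `ℂ` descends along the injection of coefficient
  -- rings.
  have hmon : ((Polynomial.X ^ (2 * m) - 1 : Polynomial CoeffRing)
      * (Polynomial.X ^ (2 * (m * τ)) - 1)).Monic :=
    (Polynomial.monic_X_pow_sub_C (1 : CoeffRing) (by omega)).mul
      (Polynomial.monic_X_pow_sub_C (1 : CoeffRing) (by omega))
  have hdvd' : (Polynomial.X ^ (2 * m) - 1 : Polynomial CoeffRing) * (Polynomial.X ^ (2 * (m * τ)) - 1)
      ∣ (Polynomial.X ^ 2 - 1) ^ 2 * P := by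
    rw [← Polynomial.map_dvd_map ev hy hmon]
    simpa using hdvd
  obtain ⟨G, hG⟩ := hdvd'
  have hG' := congrArg Polynomial.toLaurent hG
  simp only [map_mul, map_pow, map_sub, map_one, hP,
    Polynomial.toLaurent_X] at hG'
  have hk : ∀ k : ℤ, uqint (tUnit CoeffRing) k = T (-k) * (T (2 * k) - 1) := by
    intro k
    rw [uqint_tUnit, mul_sub, ← T_add, mul_one]
    congr 2
    ring
  -- This power of `T` balances `{k} = T^{-k}(T^{2k} - 1)` for `k = 1, m, mτ` and the factor `T^n`
  -- that turned the numerator into a polynomial.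
  refine ⟨T (m + m * τ - 2 - n) * Polynomial.toLaurent G, ?_⟩
  rw [hk, hk, hk]
  have e1 : (T (-1) : CoeffRing[T;T⁻¹]) ^ 2 * T (-n) * T n = T (-1) ^ 2 := by
    rw [mul_assoc, ← T_add]; simp
  have e2 : (T (-m) * T (-(m * τ)) * T (m + m * τ - 2 - n) : CoeffRing[T;T⁻¹])
      = T (-1) ^ 2 * T (-n) := by
    rw [T_pow, ← T_add, ← T_add, ← T_add]
    congr 1
    push_cast; ring
  have e3 : (T (2 * 1) : CoeffRing[T;T⁻¹]) = T 1 ^ 2 := by rw [T_pow]; rfl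
  have e4 : ∀ k : ℕ, (T (2 * k) : CoeffRing[T;T⁻¹]) = T 1 ^ (2 * k) := by
    intro k; rw [T_pow]; push_cast; rw [mul_one]
  have e5 := e4 (m * τ)
  push_cast at e5
  have hreg : IsUnit (T n : CoeffRing[T;T⁻¹]) := isUnit_T _
  refine hreg.mul_left_injective ?_
  simp only [e3, e4, e5]
  linear_combination T (-1) ^ 2 * hG'
    - (T 1 ^ (2 * m) - 1) * (T 1 ^ (2 * (m * τ)) - 1) * Polynomial.toLaurent G * (T n * e2 + e1)

end UnknotLMOV

end

noncomputable section

namespace UnknotLMOV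

open LaurentPolynomial

/-! ### Symmetric Laurent polynomials -/

/-- The substitution `T ↦ -T`. -/
def negHom (R : Type*) [CommRing R] : R[T;T⁻¹] →+* R[T;T⁻¹] := eval₂ C (-tUnit R)

/-- The Laurent polynomials that are polynomials in `(T - T⁻¹)²`. -/
def zsqRing (R : Type*) [CommRing R] : Subring (R[T;T⁻¹]) :=
  (Polynomial.eval₂RingHom (C : R →+* R[T;T⁻¹]) ((T 1 - T (-1)) ^ 2)).range

section

variable {R : Type*} [CommRing R]

theorem coeff_negHom_of_odd (f : R[T;T⁻¹]) {n : ℤ} (hn : Odd n) :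
    (negHom R f).coeff n = - f.coeff n := by
  induction f using LaurentPolynomial.induction_on' with
  | add p q hp hq =>
    rw [map_add, AddMonoidAlgebra.coeff_add, AddMonoidAlgebra.coeff_add, Finsupp.add_apply,
      Finsupp.add_apply, hp, hq, neg_add]
  | C_mul_T k a =>
    rw [negHom, eval₂_C_mul_T]
    rcases Int.even_or_odd k with hk | hk
    · have hkn : k ≠ n := by rintro rfl; exact (Int.not_even_iff_odd.2 hn) hk
      rw [hk.neg_zpow, tUnit_zpow, ← single_eq_C_mul_T,
        AddMonoidAlgebra.coeff_single, Finsupp.single_apply, if_neg hkn, neg_zero]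
    · rw [hk.neg_zpow, Units.val_neg, tUnit_zpow, mul_neg, ← single_eq_C_mul_T]
      simp

theorem C_mem_zsqRing (a : R) : (C a : R[T;T⁻¹]) ∈ zsqRing R :=
  ⟨Polynomial.C a, by simp⟩

theorem zsq_mem_zsqRing : ((T 1 - T (-1)) ^ 2 : R[T;T⁻¹]) ∈ zsqRing R :=
  ⟨Polynomial.X, by simp⟩

/-- With `s_k = T^{2k} + T^{-2k}` one has `s_{k+2} = s_1 s_{k+1} - s_k`, and `s_1 = (T - T⁻¹)² + 2`.
-/
theorem T_add_T_neg_mem (k : ℕ) : (T (2 * k) + T (-(2 * k)) : R[T;T⁻¹]) ∈ zsqRing R := by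
  have h1 : (T 1 * T (-1) : R[T;T⁻¹]) = 1 := by rw [← T_add]; simp
  have hT : ∀ k : ℕ, (T (2 * k) : R[T;T⁻¹]) = T 1 ^ (2 * k) := by
    intro k; rw [T_pow]; push_cast; rw [mul_one]
  have hT' : ∀ k : ℕ, (T (-(2 * k)) : R[T;T⁻¹]) = T (-1) ^ (2 * k) := by
    intro k; rw [T_pow]; push_cast; rw [mul_neg, mul_one]
  have h2 : (2 : R[T;T⁻¹]) ∈ zsqRing R := ofNat_mem _ 2
  have hbase : (T 1 ^ 2 + T (-1) ^ 2 : R[T;T⁻¹]) ∈ zsqRing R := by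
    have : (T 1 ^ 2 + T (-1) ^ 2 : R[T;T⁻¹]) = (T 1 - T (-1)) ^ 2 + 2 := by
      linear_combination 2 * h1
    rw [this]
    exact add_mem zsq_mem_zsqRing h2
  rw [hT, hT']
  induction k using Nat.strong_induction_on with
  | _ k ih =>
    match k with
    | 0 => rw [mul_zero, pow_zero, pow_zero, one_add_one_eq_two]; exact h2
    | 1 => simpa using hbase
    | k + 2 =>
      have h3 : (T 1 ^ (2 * (k + 2)) + T (-1) ^ (2 * (k + 2)) : R[T;T⁻¹])
          = (T 1 ^ 2 + T (-1) ^ 2) * (T 1 ^ (2 * (k + 1)) + T (-1) ^ (2 * (k + 1)))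
            - (T 1 ^ (2 * k) + T (-1) ^ (2 * k)) := by
        have h4 : (T 1 ^ 2 * T (-1) ^ 2 : R[T;T⁻¹]) = 1 := by rw [← mul_pow, h1, one_pow]
        linear_combination (- T 1 ^ (2 * k) - T (-1) ^ (2 * k)) * h4
      rw [h3]
      exact sub_mem (mul_mem hbase (ih (k + 1) (by omega))) (ih k (by omega))

/-- Induction on the degree bound: the outermost symmetric pair of terms is subtracted; it is zero
when its exponent is odd. -/
theorem mem_zsqRing_of_coeff (B : ℕ) (f : R[T;T⁻¹]) (h1 : ∀ n, f.coeff (-n) = f.coeff n)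
    (h2 : ∀ n, Odd n → f.coeff n = 0) (h3 : ∀ n : ℤ, (B : ℤ) < |n| → f.coeff n = 0) :
    f ∈ zsqRing R := by
  induction B generalizing f with
  | zero =>
    have : f = C (f.coeff 0) := by
      refine LaurentPolynomial.ext fun n => ?_
      rw [C_apply]
      split_ifs with h
      · rw [h]
      · exact h3 n (by simpa using h)
    rw [this]
    exact C_mem_zsqRing _
  | succ B ih =>
    set c := f.coeff (B + 1) with hc
    set s : R[T;T⁻¹] := T (B + 1) + T (-(B + 1)) with hs
    have hcs : C c * s ∈ zsqRing R := by
      rcases Int.even_or_odd ((B : ℤ) + 1) with h | h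
      · obtain ⟨k, hk⟩ := even_iff_two_dvd.1 h
        lift k to ℕ using by omega
        refine mul_mem (C_mem_zsqRing c) ?_
        rw [hs, hk]
        exact T_add_T_neg_mem k
      · rw [hc, h2 _ h, map_zero, zero_mul]; exact zero_mem _
    have hcoeff : ∀ n : ℤ, (C c * s).coeff n
        = (if (B : ℤ) + 1 = n then c else 0) + (if -((B : ℤ) + 1) = n then c else 0) := by
      intro n
      rw [hs, mul_add, ← single_eq_C_mul_T, ← single_eq_C_mul_T, AddMonoidAlgebra.coeff_add,
        Finsupp.add_apply, AddMonoidAlgebra.coeff_single, AddMonoidAlgebra.coeff_single,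
        Finsupp.single_apply, Finsupp.single_apply]
    have hsub : ∀ n : ℤ, (f - C c * s).coeff n = f.coeff n -
        ((if (B : ℤ) + 1 = n then c else 0) + (if -((B : ℤ) + 1) = n then c else 0)) := by
      intro n
      rw [← hcoeff, AddMonoidAlgebra.coeff_sub, Finsupp.sub_apply]
    have : f - C c * s ∈ zsqRing R := by
      refine ih _ (fun n => ?_) (fun n hn => ?_) (fun n hn => ?_)
      · rw [hsub, hsub, h1, add_comm]
        congr 3 <;> exact propext (by omega)
      · rw [hsub, h2 n hn]
        have hcn : ∀ k : ℤ, (k = B + 1 ∨ k = -(B + 1)) → (if k = n then c else 0) = 0 := by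
          intro k hk
          split_ifs with hkn
          · rw [hc, h2]
            rcases hk with rfl | rfl
            · rwa [hkn]
            · rw [← hkn] at hn; simpa using hn.neg
          · rfl
        rw [hcn _ (Or.inl rfl), hcn _ (Or.inr rfl)]; simp
      · rw [hsub]
        rcases eq_or_ne ((B : ℤ) + 1) n with h | h
        · rw [if_pos h, if_neg (by omega), ← h, ← hc]; simp
        rcases eq_or_ne (-((B : ℤ) + 1)) n with h' | h'
        · rw [if_neg h, if_pos h', ← h', h1, ← hc]; simp
        rw [if_neg h, if_neg h', h3]
        · simp
        · push_cast
          rcases abs_cases n with hh | hh <;> omega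
    simpa using add_mem this hcs

theorem mem_zsqRing [CharZero R] [NoZeroDivisors R] (f : R[T;T⁻¹]) (h1 : invert f = f)
    (h2 : negHom R f = f) : f ∈ zsqRing R := by
  obtain ⟨B, hB⟩ : ∃ B : ℕ, ∀ n ∈ f.coeff.support, n.natAbs ≤ B :=
    ⟨f.coeff.support.sup Int.natAbs, fun n hn => Finset.le_sup (f := Int.natAbs) hn⟩
  refine mem_zsqRing_of_coeff B f (fun n => ?_) (fun n hn => ?_) (fun n hn => ?_)
  · rw [← invert_apply, h1]
  · have := coeff_negHom_of_odd f hn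
    rw [h2] at this
    exact self_eq_neg.1 this
  · by_contra h
    have := hB n (Finsupp.mem_support_iff.2 h)
    rcases abs_cases n with hh | hh <;> omega

theorem uqint_inv (x : Rˣ) (k : ℤ) : uqint x⁻¹ k = - uqint x k := by
  rw [uqint, uqint, inv_zpow', inv_zpow', neg_neg, neg_sub]

theorem uqint_neg (x : Rˣ) (k : ℕ) : uqint (-x) k = (-1) ^ k * uqint x k := by
  rw [uqint, uqint, ← neg_one_mul, mul_zpow, mul_zpow, zpow_neg, zpow_natCast, ← inv_pow, inv_neg_one]
  push_cast
  ring

theorem map_uqint {S : Type*} [CommRing S] (f : R →+* S) (x : Rˣ) (k : ℤ) :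
    f (uqint x k) = uqint (Units.map (f : R →* S) x) k := by
  rw [uqint, map_sub, uqint, ← map_zpow, ← map_zpow]; rfl

end

theorem neg_one_pow_mul_self {R : Type*} [CommRing R] (n : ℕ) : (-1 : R) ^ n * (-1) ^ n = 1 := by
  rw [← mul_pow]; simp

instance : CharZero CoeffRing :=
  charZero_of_injective_ringHom (f := (C : ℤ →+* CoeffRing)) fun a b h => by
    have := congrArg (fun f : CoeffRing => f.coeff 0) h
    simpa only [C_apply, if_true] using this

/-- `z² {m} {mτ} g_m` is `{m} {mτ}` times a polynomial in `z²` over `ℤ[y, y⁻¹]`. -/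
theorem exists_zsq_quotient (τ m : ℕ) (hτ : 0 < τ) (hm : 0 < m) :
    ∃ f ∈ zsqRing CoeffRing, uqint (tUnit CoeffRing) 1 ^ 2 * univNum τ m
      = uqint (tUnit CoeffRing) m * uqint (tUnit CoeffRing) (m * τ) * f := by
  obtain ⟨f, hf⟩ := exists_quotient τ m hτ hm
  refine ⟨f, ?_, hf⟩
  have h0 : uqint (tUnit CoeffRing) m * uqint (tUnit CoeffRing) (m * τ) ≠ 0 :=
    mul_ne_zero (uqint_tUnit_ne_zero _ (by exact_mod_cast hm))
      (uqint_tUnit_ne_zero _ (by exact_mod_cast Nat.mul_pos hm hτ))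
  -- Both substitutions change the two sides of `hf` by the same sign, and `h0` allows cancellation,
  -- so `f` is invariant.
  refine mem_zsqRing f ?_ ?_
  · set σ : CoeffRing[T;T⁻¹] →+* CoeffRing[T;T⁻¹] :=
      (invert (R := CoeffRing)).toAlgHom.toRingHom with hσ
    have hx : Units.map (σ : _ →* CoeffRing[T;T⁻¹]) (tUnit CoeffRing) = (tUnit CoeffRing)⁻¹ := by
      ext1
      change invert (T 1) = T (-1)
      rw [invert_T]
    have hy : Units.map (σ : _ →* CoeffRing[T;T⁻¹]) yUnit = yUnit := by
      ext1
      exact invert_C _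
    have h := congrArg σ hf
    rw [map_mul, map_mul, map_mul, map_pow, univNum, map_lmovNum, map_uqint, map_uqint, map_uqint,
      hx, hy, lmovNum_inv, uqint_inv, uqint_inv, uqint_inv, ← univNum] at h
    refine mul_left_cancel₀ h0 ?_
    change _ * σ f = _
    linear_combination hf - h
  · have hx : Units.map (negHom CoeffRing : _ →* CoeffRing[T;T⁻¹]) (tUnit CoeffRing)
        = -(tUnit CoeffRing) := by
      ext1
      change negHom CoeffRing (T 1) = _
      rw [negHom, eval₂_T, zpow_one]
    have hy : Units.map (negHom CoeffRing : _ →* CoeffRing[T;T⁻¹]) yUnit = yUnit := by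
      ext1
      exact eval₂_C _ _ _
    have h := congrArg (negHom CoeffRing) hf
    have e1 := uqint_neg (tUnit CoeffRing) 1
    have e2 := uqint_neg (tUnit CoeffRing) (m * τ)
    rw [Nat.cast_one] at e1
    rw [Nat.cast_mul] at e2
    rw [map_mul, map_mul, map_mul, map_pow, univNum, map_lmovNum, map_uqint, map_uqint, map_uqint,
      hx, hy, lmovNum_neg, e1, e2, uqint_neg, ← univNum] at h
    have h3 := neg_one_pow_mul_self (R := CoeffRing[T;T⁻¹]) (m + m * τ)
    refine mul_left_cancel₀ h0 ?_
    rw [← hf]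
    rw [pow_add] at h h3
    linear_combination (-(-1) ^ m * (-1) ^ (m * τ)) * h + (uqint (tUnit CoeffRing) 1 ^ 2 * univNum τ m
      - uqint (tUnit CoeffRing) m * uqint (tUnit CoeffRing) (m * τ) * negHom CoeffRing f) * h3

end UnknotLMOV

end

noncomputable section

namespace UnknotLMOV

open LaurentPolynomial

/-! ### The field of rational functions -/

theorem ratField_algebraMap_injective :
    Function.Injective (algebraMap (MvPolynomial (Fin 2) ℚ) RatField) :=
  IsFractionRing.injective _ _

theorem qh_ne_zero : qh ≠ 0 := by
  rw [qh, Ne, map_eq_zero_iff _ ratField_algebraMap_injective]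
  exact MvPolynomial.X_ne_zero 0

theorem ah_ne_zero : ah ≠ 0 := by
  rw [ah, Ne, map_eq_zero_iff _ ratField_algebraMap_injective]
  exact MvPolynomial.X_ne_zero 1

/-- `q^{1/2}` as a unit. -/
def qUnit : RatFieldˣ := Units.mk0 qh qh_ne_zero

/-- `a^{1/2}` as a unit. -/
def aUnit : RatFieldˣ := Units.mk0 ah ah_ne_zero

theorem uqint_qUnit_ne_zero (k : ℕ) (hk : 0 < k) : uqint qUnit k ≠ 0 := by
  intro h
  have h1 : qUnit ^ (k : ℤ) = qUnit ^ (-(k : ℤ)) := Units.ext (sub_eq_zero.1 h)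
  rw [zpow_neg, zpow_natCast, eq_inv_iff_mul_eq_one, ← pow_add] at h1
  have h2 : qh ^ (k + k) = 1 := congrArg Units.val h1
  rw [qh, ← map_pow, map_eq_one_iff _ ratField_algebraMap_injective] at h2
  have h3 := congrArg (MvPolynomial.eval (fun _ : Fin 2 => (0 : ℚ))) h2
  rw [map_pow, MvPolynomial.eval_X, zero_pow (by omega), map_one] at h3
  exact zero_ne_one h3

theorem uqint_qUnit_one : uqint qUnit 1 = zvar := by
  simp [uqint, zvar, qUnit]

theorem zvar_ne_zero : zvar ≠ 0 := by
  have := uqint_qUnit_ne_zero 1 one_pos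
  rwa [Nat.cast_one, uqint_qUnit_one] at this

/-- The value of a polynomial in `z²` with coefficients in `ℤ[y, y⁻¹]`. -/
def zEval (y : RatFieldˣ) : Polynomial CoeffRing →+* RatField :=
  Polynomial.eval₂RingHom (eval₂ (Int.castRingHom RatField) y) (zvar ^ 2)

theorem evalTwo_eval₂ (y : RatFieldˣ) (F : Polynomial CoeffRing) :
    evalTwo qUnit y (F.eval₂ C ((T 1 - T (-1)) ^ 2)) = zEval y F := by
  rw [Polynomial.hom_eval₂, zEval, Polynomial.coe_eval₂RingHom]
  congr 1
  · refine RingHom.ext fun p => ?_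
    simp [evalTwo]
  · rw [map_pow, map_sub, evalTwo, eval₂_T, eval₂_T, ← uqint, uqint_qUnit_one]

/-- The unit `y` is left general because negative framings require `a^{-1/2}` in place of `a^{1/2}`.
-/
theorem zEval_mem (y : RatFieldˣ) (hy : (y : RatField) ∈ intRing) (hy' : ((y⁻¹ : RatFieldˣ) : RatField) ∈ intRing)
    (F : Polynomial CoeffRing) : zEval y F ∈ intRing := by
  have hz : zvar ^ 2 ∈ intRing := Subring.subset_closure (by simp)
  have h1 : ∀ p : CoeffRing, eval₂ (Int.castRingHom RatField) y p ∈ intRing := by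
    intro p
    induction p using LaurentPolynomial.induction_on' with
    | add p q hp hq => rw [map_add]; exact add_mem hp hq
    | C_mul_T k a =>
      rw [eval₂_C_mul_T]
      refine mul_mem (intCast_mem _ _) ?_
      rcases Int.eq_nat_or_neg k with ⟨n, rfl | rfl⟩
      · rw [zpow_natCast, Units.val_pow_eq_pow_val]; exact pow_mem hy n
      · rw [zpow_neg, zpow_natCast, ← inv_pow, Units.val_pow_eq_pow_val]; exact pow_mem hy' n
  induction F using Polynomial.induction_on' with
  | add p q hp hq => rw [map_add]; exact add_mem hp hq
  | monomial n a =>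
    rw [zEval, Polynomial.coe_eval₂RingHom, Polynomial.eval₂_monomial]
    exact mul_mem (h1 a) (pow_mem hz n)

theorem exists_zEval_of_mem {f : RatField} (hf : f ∈ intRing) :
    ∃ F : Polynomial CoeffRing, f = zEval aUnit F := by
  have : intRing ≤ (zEval aUnit).range := by
    rw [intRing, Subring.closure_le]
    rintro x (rfl | rfl | rfl)
    · exact ⟨Polynomial.X, by simp [zEval]⟩
    · exact ⟨Polynomial.C (T 1), by simp [zEval, aUnit]⟩
    · exact ⟨Polynomial.C (T (-1)), by simp [zEval, aUnit]⟩
  obtain ⟨F, hF⟩ := this hf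
  exact ⟨F, hF.symm⟩

theorem ah_mem_intRing : ah ∈ intRing := Subring.subset_closure (by simp)

theorem ah_inv_mem_intRing : ah⁻¹ ∈ intRing := Subring.subset_closure (by simp)

theorem zvar_sq_mul_gfun_mem (τ m : ℕ) (hτ : 0 < τ) (hm : 0 < m) (y : RatFieldˣ)
    (hy : (y : RatField) ∈ intRing) (hy' : ((y⁻¹ : RatFieldˣ) : RatField) ∈ intRing) :
    zvar ^ 2 * gfun (τ : ℤ) m qh (y : RatField) ∈ intRing := by
  obtain ⟨f, ⟨F, rfl⟩, hF⟩ := exists_zsq_quotient τ m hτ hm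
  have h := congrArg (evalTwo qUnit y) hF
  rw [Polynomial.coe_eval₂RingHom, map_mul, map_mul, map_mul, map_pow, map_uqint, map_uqint,
    map_uqint, map_evalTwo_x, evalTwo_univNum, uqint_qUnit_one, evalTwo_eval₂] at h
  have h1 : gfun (τ : ℤ) m qh (y : RatField)
      = lmovNum τ m qUnit y / (uqint qUnit m * uqint qUnit (m * τ)) :=
    gfun_eq τ m hτ qUnit y uqint_qUnit_ne_zero
  have h2 : uqint qUnit m * uqint qUnit (m * τ) ≠ 0 :=
    mul_ne_zero (uqint_qUnit_ne_zero m hm)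
      (by exact_mod_cast uqint_qUnit_ne_zero (m * τ) (Nat.mul_pos hm hτ))
  rw [h1, ← mul_div_assoc, h, mul_div_cancel_left₀ _ h2]
  exact zEval_mem y hy hy' F

theorem zvar_sq_mul_g_mem (τ : ℤ) (m : ℕ) (hm : 0 < m) : zvar ^ 2 * g τ m ∈ intRing := by
  rcases lt_trichotomy τ 0 with h | rfl | h
  · obtain ⟨t, ht⟩ := Int.eq_ofNat_of_zero_le (a := -τ) (by omega)
    have ha : ((aUnit⁻¹ : RatFieldˣ) : RatField) = ah⁻¹ := by simp [aUnit]
    have h1 := zvar_sq_mul_gfun_mem t m (by omega) hm aUnit⁻¹ (ha ▸ ah_inv_mem_intRing)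
      (by rw [inv_inv]; exact ah_mem_intRing)
    rw [ha] at h1
    rw [g, gfun_neg _ h.ne, ht, mul_neg]
    exact neg_mem h1
  · rw [g, gfun_zero m hm]
    split_ifs with h1
    · have h2 : qint qh 1 = zvar := by simp [qint, zvar]
      rw [h2, mul_div_cancel₀ _ (pow_ne_zero 2 zvar_ne_zero)]
      simpa [qint] using sub_mem ah_mem_intRing ah_inv_mem_intRing
    · rw [mul_zero]; exact zero_mem _
  · obtain ⟨t, rfl⟩ := Int.eq_ofNat_of_zero_le h.le
    refine zvar_sq_mul_gfun_mem t m (by omega) hm aUnit ?_ ?_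
    · exact ah_mem_intRing
    · simpa [aUnit] using ah_inv_mem_intRing

/-! ### Regular functions along `q^{1/2} = 1` -/

/-- Restriction of polynomials to `q^{1/2} = 1`. -/
def restr : MvPolynomial (Fin 2) ℚ →ₐ[ℚ] Polynomial ℚ :=
  MvPolynomial.aeval ![1, Polynomial.X]

/-- Modulo `X 0 - 1`, restriction followed by the inclusion of polynomials in `X 1` is the identity.
-/
theorem dvd_of_restr_eq_zero (v : MvPolynomial (Fin 2) ℚ) (h : restr v = 0) :
    MvPolynomial.X 0 - 1 ∣ v := by
  set I := Ideal.span {(MvPolynomial.X 0 - 1 : MvPolynomial (Fin 2) ℚ)} with hI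
  have h1 : ((Ideal.Quotient.mkₐ ℚ I).comp (Polynomial.aeval (MvPolynomial.X 1))).comp restr
      = Ideal.Quotient.mkₐ ℚ I := by
    refine MvPolynomial.algHom_ext fun i => ?_
    fin_cases i
    · simp only [restr, AlgHom.comp_apply, MvPolynomial.aeval_X, Fin.zero_eta, Matrix.cons_val_zero,
        map_one]
      symm
      rw [← sub_eq_zero, ← map_one (Ideal.Quotient.mkₐ ℚ I), ← map_sub]
      exact Ideal.Quotient.eq_zero_iff_mem.2 (Ideal.mem_span_singleton_self _)
    · simp [restr]
  have h2 := DFunLike.congr_fun h1 v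
  rw [AlgHom.comp_apply, h, map_zero] at h2
  exact Ideal.mem_span_singleton.1 (Ideal.Quotient.eq_zero_iff_mem.1 h2.symm)

theorem restr_eq_zero_iff (v : MvPolynomial (Fin 2) ℚ) :
    restr v = 0 ↔ MvPolynomial.X 0 - 1 ∣ v := by
  refine ⟨dvd_of_restr_eq_zero v, ?_⟩
  rintro ⟨w, rfl⟩
  simp [restr]

/-- The ring of rational functions without a pole along `q^{1/2} = 1`. -/
def regularRing : Subring RatField where
  carrier := {f | RegularAtOne f}
  mul_mem' := by
    rintro f f' ⟨u, v, hv, h⟩ ⟨u', v', hv', h'⟩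
    refine ⟨u * u', v * v', ?_, ?_⟩
    -- The target of `restr` is a domain, so the product of admissible denominators is admissible.
    · rw [← restr_eq_zero_iff] at *
      rw [map_mul]; exact mul_ne_zero hv hv'
    · rw [map_mul, map_mul, ← h, ← h']; ring
  one_mem' := ⟨1, 1, by rw [← restr_eq_zero_iff]; simp, by simp⟩
  add_mem' := by
    rintro f f' ⟨u, v, hv, h⟩ ⟨u', v', hv', h'⟩
    refine ⟨u * v' + u' * v, v * v', ?_, ?_⟩
    · rw [← restr_eq_zero_iff] at *
      rw [map_mul]; exact mul_ne_zero hv hv'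
    · rw [map_mul, map_add, map_mul, map_mul, ← h, ← h']; ring
  zero_mem' := ⟨0, 1, by rw [← restr_eq_zero_iff]; simp, by simp⟩
  neg_mem' := by
    rintro f ⟨u, v, hv, h⟩
    exact ⟨-u, v, hv, by rw [map_neg, ← h, neg_mul]⟩

theorem intRing_le_regularRing : intRing ≤ regularRing := by
  rw [intRing, Subring.closure_le]
  have hq : qh ∈ regularRing := ⟨MvPolynomial.X 0, 1, by rw [← restr_eq_zero_iff]; simp, by simp [qh]⟩
  have hq' : qh⁻¹ ∈ regularRing := ⟨1, MvPolynomial.X 0, by rw [← restr_eq_zero_iff]; simp [restr], by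
    rw [map_one]; exact inv_mul_cancel₀ qh_ne_zero⟩
  rintro x (rfl | rfl | rfl)
  · exact pow_mem (sub_mem hq hq') 2
  · exact ⟨MvPolynomial.X 1, 1, by rw [← restr_eq_zero_iff]; simp, by simp [ah]⟩
  · exact ⟨1, MvPolynomial.X 1, by rw [← restr_eq_zero_iff]; simp [restr], by
      rw [map_one]; exact inv_mul_cancel₀ ah_ne_zero⟩

theorem eval₂_eq_sum {R : Type*} [CommRing R] (f : R →+* RatField) (p : R[T;T⁻¹]) :
    eval₂ f aUnit p = p.coeff.sum fun k c => f c * ah ^ k := by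
  induction p using LaurentPolynomial.induction_on' with
  | add p q hp hq =>
    rw [map_add, hp, hq, AddMonoidAlgebra.coeff_add, Finsupp.sum_add_index']
    · simp
    · intro k a b; rw [map_add, add_mul]
  | C_mul_T k a =>
    rw [eval₂_C_mul_T, ← single_eq_C_mul_T, AddMonoidAlgebra.coeff_single, Finsupp.sum_single_index]
    · simp [aUnit]
    · simp

/-- A Laurent polynomial in `a^{1/2}` divisible by `z²` in the ring of regular functions is zero. -/
theorem eq_zero_of_eval₂_eq (p : ℚ[T;T⁻¹]) (r : RatField) (hr : RegularAtOne r)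
    (h : eval₂ (algebraMap ℚ RatField) aUnit p = zvar ^ 2 * r) : p = 0 := by
  obtain ⟨n, P, hP⟩ := exists_T_pow p
  obtain ⟨u, v, hv, huv⟩ := hr
  have h1 := congrArg (eval₂ (algebraMap ℚ RatField) aUnit) hP
  rw [eval₂_toLaurent, map_mul, h, eval₂_T, zpow_natCast, Units.val_pow_eq_pow_val,
    show (aUnit : RatField) = ah from rfl] at h1
  have h2 : Polynomial.eval₂ (algebraMap ℚ RatField) ah P
      = algebraMap (MvPolynomial (Fin 2) ℚ) RatField (Polynomial.aeval (MvPolynomial.X 1) P) := by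
    rw [← Polynomial.aeval_algebraMap_apply, ← ah, Polynomial.aeval_def]
  have h3 : zvar * qh = qh ^ 2 - 1 := by
    rw [zvar, sub_mul, inv_mul_cancel₀ qh_ne_zero, sq]
  have h4 : algebraMap (MvPolynomial (Fin 2) ℚ) RatField
        (Polynomial.aeval (MvPolynomial.X 1) P * v * MvPolynomial.X 0 ^ 2)
      = algebraMap (MvPolynomial (Fin 2) ℚ) RatField
        ((MvPolynomial.X 0 ^ 2 - 1) ^ 2 * u * MvPolynomial.X 1 ^ n) := by
    simp only [map_mul, map_pow, map_sub, map_one]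
    rw [← h2, h1, ← huv, ← qh, ← ah, ← h3]
    ring
  -- Restriction to `q^{1/2} = 1` kills the right side, since `X 0 ^ 2 - 1` restricts to zero, and
  -- sends the left side to `P` times the nonzero restriction of `v`.
  have h5 := congrArg restr (ratField_algebraMap_injective h4)
  have h6 : restr (Polynomial.aeval (MvPolynomial.X 1) P) = P := by
    rw [← Polynomial.aeval_algHom_apply]
    simp [restr]
  rw [map_mul, map_mul, h6] at h5
  have h7 : restr (MvPolynomial.X 0) = 1 := by simp [restr]
  simp only [map_mul, map_pow, map_sub, map_one, h7, one_pow, sub_self, mul_one, ne_eq,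
    OfNat.ofNat_ne_zero, not_false_eq_true, zero_pow, zero_mul] at h5
  have h8 : P = 0 := (mul_eq_zero.1 h5).resolve_right fun h9 => hv (dvd_of_restr_eq_zero v h9)
  rw [h8, map_zero] at hP
  exact (isUnit_T (R := ℚ) (n : ℤ)).mul_left_eq_zero.1 hP.symm

/-! ### Existence, uniqueness and finiteness of the expansion. -/

/-- The term of genus `h` of an expansion, as a Laurent polynomial in `a^{1/2}` times `z^{2h}`. -/
theorem sum_term_eq (n : ℤ →₀ ℚ) (h : ℕ) :
    (n.sum fun k c => (c : RatField) * zvar ^ (2 * h) * ah ^ k)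
      = zvar ^ (2 * h) * eval₂ (algebraMap ℚ RatField) aUnit (AddMonoidAlgebra.ofCoeff n) := by
  rw [eval₂_eq_sum, AddMonoidAlgebra.coeff_ofCoeff, Finsupp.mul_sum]
  refine Finsupp.sum_congr fun k _ => ?_
  rw [eq_ratCast]; ring

theorem IsExpansion.unique {τ : ℤ} {m : ℕ} {n n' : ℕ → ℤ →₀ ℚ} (H : IsExpansion τ m n)
    (H' : IsExpansion τ m n') : n = n' := by
  funext h
  induction h using Nat.strong_induction_on with
  | _ h ih =>
    -- Truncation after genus `h`: lower terms agree by induction, so the two terms of genus `h`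
    -- differ by `z^{2h+2}` times a regular function.
    obtain ⟨r, hr, e⟩ := H (h + 1)
    obtain ⟨r', hr', e'⟩ := H' (h + 1)
    rw [e, Finset.sum_range_succ, Finset.sum_range_succ,
      Finset.sum_congr rfl fun i hi => by rw [ih i (Finset.mem_range.1 hi)], sum_term_eq,
      sum_term_eq] at e'
    have hd : RegularAtOne (r' - r) := regularRing.sub_mem hr' hr
    have h1 : eval₂ (algebraMap ℚ RatField) aUnit (AddMonoidAlgebra.ofCoeff (n h) - AddMonoidAlgebra.ofCoeff (n' h))
        = zvar ^ 2 * (r' - r) := by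
      refine mul_left_cancel₀ (pow_ne_zero (2 * h) zvar_ne_zero) ?_
      rw [map_sub]
      linear_combination e'
    have h2 := sub_eq_zero.1 (eq_zero_of_eval₂_eq _ _ hd h1)
    exact congrArg AddMonoidAlgebra.coeff h2

/-- The coefficients of a polynomial in `z²` with coefficients in `ℤ[y, y⁻¹]`. -/
def expansionOf (F : Polynomial CoeffRing) (h : ℕ) : ℤ →₀ ℚ :=
  (F.coeff h).coeff.mapRange (fun c : ℤ => (c : ℚ)) Int.cast_zero

theorem isExpansion_expansionOf {τ : ℤ} {m : ℕ} (F : Polynomial CoeffRing)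
    (hF : zvar ^ 2 * g τ m = zEval aUnit F) : IsExpansion τ m (expansionOf F) := by
  intro N
  set A : Polynomial CoeffRing :=
    ∑ h ∈ Finset.range N, Polynomial.monomial h (F.coeff h) with hA
  -- The terms of `F` of degree at least `N` form the remainder, whose quotient by `z^{2N}` lies in
  -- `intRing` and is therefore regular.
  have hdvd : Polynomial.X ^ N ∣ F - A := by
    rw [Polynomial.X_pow_dvd_iff]
    intro d hd
    rw [hA, Polynomial.coeff_sub, Polynomial.finsetSum_coeff,
      Finset.sum_eq_single d (fun i _ hi => Polynomial.coeff_monomial_of_ne _ hi.symm)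
        (fun h => absurd (Finset.mem_range.2 hd) h), Polynomial.coeff_monomial_same, sub_self]
  obtain ⟨G, hG⟩ := hdvd
  refine ⟨zEval aUnit G, intRing_le_regularRing (zEval_mem aUnit ah_mem_intRing
    (by simpa [aUnit] using ah_inv_mem_intRing) G), ?_⟩
  have h1 : zEval aUnit A = ∑ h ∈ Finset.range N,
      (expansionOf F h).sum fun k c => (c : RatField) * zvar ^ (2 * h) * ah ^ k := by
    rw [hA, map_sum]
    refine Finset.sum_congr rfl fun h _ => ?_
    rw [zEval, Polynomial.coe_eval₂RingHom, Polynomial.eval₂_monomial, eval₂_eq_sum, expansionOf,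
      Finsupp.sum_mapRange_index (by simp), Finsupp.sum_mul, ← pow_mul]
    refine Finsupp.sum_congr fun k _ => ?_
    rw [eq_intCast, Rat.cast_intCast]; ring
  rw [hF, ← h1, eq_add_of_sub_eq' hG, map_add, map_mul, map_pow]
  congr 2
  simp [zEval, pow_mul]

theorem exists_bound (F : Polynomial CoeffRing) :
    ∃ B : ℕ, ∀ (h : ℕ) (k : ℤ), (B < h ∨ (B : ℤ) < |k|) → expansionOf F h k = 0 := by
  refine ⟨F.natDegree + (Finset.range (F.natDegree + 1)).sup fun h =>
    (F.coeff h).coeff.support.sup Int.natAbs, fun h k hB => ?_⟩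
  suffices (F.coeff h).coeff k = 0 by simp [expansionOf, this]
  by_contra hne
  have h1 : h ≤ F.natDegree := Polynomial.le_natDegree_of_ne_zero fun h0 => hne (by simp [h0])
  have h2 : k.natAbs ≤ (F.coeff h).coeff.support.sup Int.natAbs :=
    Finset.le_sup (f := Int.natAbs) (Finsupp.mem_support_iff.2 hne)
  have h3 := Finset.le_sup (f := fun h => (F.coeff h).coeff.support.sup Int.natAbs)
    (Finset.mem_range.2 (show h < F.natDegree + 1 by omega))
  have h4 := h2.trans h3
  rcases hB with hB | hB
  · omega
  · rw [Int.abs_eq_natAbs] at hB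
    omega

end UnknotLMOV

end

theorem theorem1p3 (τ : ℤ) (m : ℕ) (hm : 1 ≤ m) :
    (∃ f ∈ UnknotLMOV.intRing, UnknotLMOV.g τ m = UnknotLMOV.zvar ^ (-2 : ℤ) * f) ∧
    (∃! n : ℕ → ℤ →₀ ℚ, UnknotLMOV.IsExpansion τ m n) ∧
    (∀ n : ℕ → ℤ →₀ ℚ, UnknotLMOV.IsExpansion τ m n →
      (∀ (h : ℕ) (k : ℤ), ∃ c : ℤ, n h k = (c : ℚ)) ∧
      (∃ B : ℕ, ∀ (h : ℕ) (k : ℤ), (B < h ∨ (B : ℤ) < |k|) → n h k = 0)) := by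
  have hmem := UnknotLMOV.zvar_sq_mul_g_mem τ m hm
  obtain ⟨F, hF⟩ := UnknotLMOV.exists_zEval_of_mem hmem
  have hE := UnknotLMOV.isExpansion_expansionOf F hF
  refine ⟨⟨_, hmem, ?_⟩, ⟨_, hE, fun n hn => hn.unique hE⟩, fun n hn => ?_⟩
  · rw [← mul_assoc, zpow_neg, zpow_ofNat,
      inv_mul_cancel₀ (pow_ne_zero 2 UnknotLMOV.zvar_ne_zero), one_mul]
  -- By uniqueness every expansion is the one read off from `F`, whose coefficients are integral and
  -- finite in number.
  · obtain rfl := hn.unique hE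
    exact ⟨fun h k => ⟨(F.coeff h).coeff k, by simp [UnknotLMOV.expansionOf]⟩,
      UnknotLMOV.exists_bound F⟩
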